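/- **Definitions.** *Spectra.* For a positive semidefinite matrix $M$, $\gamma(M)$ denotes its smallest nonzero eigenvalue. *Bose–Hubbard model.* For a finite graph $G$ with adjacency matrix $A(G)$ (self-loops allowed), let $\mu(G)$ be the smallest eigenvalue of $A(G)$. On $(\mathbb C^{V(G)})^{\otimes N}$ put $$H_G^N=\sum_{i=1}^N A(G)^{(i)}+\sum_{k\in V(G)}\hat n_k(\hat n_k-1),\qquad \hat n_k=\sum_{i=1}^N |k\rangle\langle k|^{(i)},$$ where $M^{(i)}$ acts as $M$ on the $i$-th register and as the identity on the others. Let $\lambda_N^1(G)$ be the smallest eigenvalue of $H_G^N-N\mu(G)$ restricted to the subspace $\mathcal Z_N(G)$ of states symmetric under permutation of the $N$ registers. *The graph $g_0$.* It is the simple graph with the 128 vertices $(z,t,j)$, $z\in\{0,1\}$, $t\in\{1,\dots,8\}$, $j\in\{0,\dots,7\}$ ($t$ and $j$ modulo 8) and adjacency matrix $$A(g_0)=\sum_{t=1}^8\bigl(|t+1\rangle\langle t|\otimes B(U_t)+\text{h.c.}\bigr)+1_z\otimes1_t\otimes(S^3+S^4+S^5),$$ where $S|j\rangle=|j+1 \bmod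 8\rangle$, $(U_1,\dots,U_8)=(H,H,HT,(HT)^\dagger,HT,(HT)^\dagger,H,H)$ with $$H=\tfrac1{\sqrt2}\begin{pmatrix}1&1\\1&-1\end{pmatrix},\qquad T=\begin{pmatrix}1&0\\0&e^{i\pi/4}\end{pmatrix},$$ and $B(U)$, acting on the registers $z,j$, is obtained from $-\sqrt2\,U$ by replacing each entry $e^{i\pi k/4}$ by $S^k$. Its smallest eigenvalue is $e_1=-1-3\sqrt2$. *Gate graphs.* A gate diagram with $R$ diagram elements gives each $q\in[R]$ a label $1$, $H$ or $HT$; the nodes of element $q$ are $(q,z,t)$ with $z\in\{0,1\}$ and $t\in\{1,3,5,7\}$, $\{1,3,2,8\}$ or $\{1,3,4,6\}$, respectively. It consists further of a set $\mathcal S$ of nodes (self-loops) and a set $\mathcal E$ of pairs of distinct nodes (edges), such that no node lies in two edges, or in both an edge and $\mathcal S$. Its gate graph $G$ has vertices $(q,z,t,j)$, with $q\in[R]$ and $z,t,j$ as for $g_0$, and adjacency matrix $$A(G)=1_q\otimes A(g_0)+\sum_{n\in\mathcal S}|n\rangle\langle n|\otimes 1_j+\sum_{\{n,n'\}\in\mathcal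 E}(|n\rangle+|n'\rangle)(\langle n|+\langle n'|)\otimes 1_j .$$ $G$ is an *$e_1$-gate graph* if the smallest eigenvalue of $A(G)$ is $e_1$. *The graph $G^{\rm SL}$.* Let $\mathcal N$ be the set of vertices $(q,z,t,j)$ of $G$ such that $(q,z,t)$ is neither in $\mathcal S$ nor in an edge of $\mathcal E$, and let $\Pi_{\mathcal N}=\sum_{v\in\mathcal N}|v\rangle\langle v|$. $G^{\rm SL}$ has vertex set $V(G)\times\{0,1\}$ and adjacency matrix $$A(G^{\rm SL})=A(G)\otimes 1+2\,\Pi_{\mathcal N}\otimes\Pi_+,\qquad \Pi_+=\tfrac12(|0\rangle+|1\rangle)(\langle0|+\langle1|).$$ **Lemma.** (i) Let $G$ be an $e_1$-gate graph. For every $N$ and every real $a$, if $\lambda_N^1(G)\le a$, then $\lambda_N^1(G^{\rm SL})\le\frac32a$. (ii) There is an absolute constant $C_1>0$ such that, for every $e_1$-gate graph $G$ described by a gate diagram with $R$ diagram elements, every $N$ and all real $C_0$, $b$: if $\gamma(A(G)-e_1)\ge C_0/R^3$ and $\lambda_N^1(G)\ge b>0$, then $$\lambda_N^1(G^{\rm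 SL})\ge\frac{C_0C_1}{R^3N^2}\,b .$$ -/

import Mathlib

open scoped Kronecker

noncomputable section

namespace BoseHubbard

/-! ### Spectra -/

/-- The real eigenvalues of the restriction of the matrix `M` to the (invariant) subspace `Z`. -/
def eigenvaluesOn {ι : Type*} [Fintype ι] (M : Matrix ι ι ℂ) (Z : Submodule ℂ (ι → ℂ)) : Set ℝ :=
  {x | ∃ v ∈ Z, v ≠ 0 ∧ M.mulVec v = (x : ℂ) • v}

/-- The real eigenvalues of the matrix `M`. -/
def eigenvalues {ι : Type*} [Fintype ι] (M : Matrix ι ι ℂ) : Set ℝ :=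
  eigenvaluesOn M ⊤

/-- The smallest eigenvalue `μ` of an adjacency matrix. -/
def minEigenvalue {ι : Type*} [Fintype ι] (A : Matrix ι ι ℂ) : ℝ :=
  sInf (eigenvalues A)

/-- `γ(M)`: the smallest nonzero eigenvalue of a positive semidefinite matrix `M`. -/
def gap {ι : Type*} [Fintype ι] (M : Matrix ι ι ℂ) : ℝ :=
  sInf {x | x ∈ eigenvalues M ∧ x ≠ 0}

/-! ### The Bose-Hubbard model

A graph with vertex set `V` is given by its adjacency matrix `A : Matrix V V ℂ`. The space of `N`
distinguishable particles `(ℂ^V)^{⊗N}` is `(Fin N → V) → ℂ`; the basis state `|x₁ … x_N⟩` is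
`Pi.single x 1`. -/

section Model

variable {V : Type*} [Fintype V] [DecidableEq V]

/-- `M^{(i)}`: the operator `M` on the `i`-th register, the identity on all the others. -/
def onRegister (N : ℕ) (M : Matrix V V ℂ) (i : Fin N) : Matrix (Fin N → V) (Fin N → V) ℂ :=
  Matrix.of fun x y => if ∀ j, j ≠ i → x j = y j then M (x i) (y i) else 0

/-- The number operator `n̂_k = ∑ᵢ |k⟩⟨k|^{(i)}`. -/
def numberOp (N : ℕ) (k : V) : Matrix (Fin N → V) (Fin N → V) ℂ :=
  ∑ i : Fin N, onRegister N (Matrix.single k k (1 : ℂ)) i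

/-- `H_G^N = ∑ᵢ A(G)^{(i)} + ∑_k n̂_k (n̂_k - 1)` on the distinguishable-particle space. -/
def hamiltonian (N : ℕ) (A : Matrix V V ℂ) : Matrix (Fin N → V) (Fin N → V) ℂ :=
  ∑ i : Fin N, onRegister N A i + ∑ k : V, numberOp N k * (numberOp N k - 1)

/-- `Sym(|x₁ … x_N⟩) = (N!)^{-1/2} ∑_π |x_{π(1)} … x_{π(N)}⟩`. -/
def symState (N : ℕ) (x : Fin N → V) : (Fin N → V) → ℂ :=
  ((1 / Real.sqrt (N.factorial : ℝ) : ℝ) : ℂ) •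
    ∑ p : Equiv.Perm (Fin N), Pi.single (x ∘ p) (1 : ℂ)

variable (V) in
/-- The bosonic space `Z_N(G)`. -/
def bosonicSpace (N : ℕ) : Submodule ℂ ((Fin N → V) → ℂ) :=
  Submodule.span ℂ (Set.range (symState (V := V) N))

/-- `λ_N^1(G)`: the smallest eigenvalue of `H(G,N) = H_G^N - N μ(G)` restricted to `Z_N(G)`. -/
def groundEnergy (N : ℕ) (A : Matrix V V ℂ) : ℝ :=
  sInf (eigenvaluesOn (hamiltonian N A - (((N : ℝ) * minEigenvalue A : ℝ) : ℂ) • 1)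
    (bosonicSpace V N))

end Model

/-! ### The graph `g₀`

Vertices are triples `(z, t, j)`. Both `t ∈ {1, …, 8}` and `j ∈ {0, …, 7}` are taken modulo `8`
(so `t = 8` is `0`). With `ω = exp(iπ/4)`, the entries of `-√2 H`, `-√2 HT`, `-√2 (HT)†` are powers
of `ω`; the tables below list the exponents. Around the cycle `t = 1 → 2 → ⋯ → 8 → 1` the gates
`H, H, HT, (HT)†, HT, (HT)†, H, H` are applied, each `ω^k` becomes the shift `j ↦ j + k` on the
last register, and finally the shifts by `3, 4, 5` on the last register are added:
`A(g₀) = ∑ₜ (|t+1⟩⟨t| ⊗ B(Uₜ) + h.c.) + 1 ⊗ 1 ⊗ (S³ + S⁴ + S⁵)`. -/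

abbrev G0Vertex : Type := Fin 2 × ZMod 8 × ZMod 8

def expH : Matrix (Fin 2) (Fin 2) (ZMod 8) := !![4, 4; 4, 0]
def expHT : Matrix (Fin 2) (Fin 2) (ZMod 8) := !![4, 5; 4, 1]
def expHTdag : Matrix (Fin 2) (Fin 2) (ZMod 8) := !![4, 4; 3, 7]

/-- Exponents of the gate applied between times `t` and `t + 1`. -/
def gateExp (t : ZMod 8) : Matrix (Fin 2) (Fin 2) (ZMod 8) :=
  if t = 3 ∨ t = 5 then expHT else if t = 4 ∨ t = 6 then expHTdag else expH

/-- A step forward in time, from `v` to `w`. -/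
def G0Step (v w : G0Vertex) : Prop :=
  w.2.1 = v.2.1 + 1 ∧ w.2.2 = v.2.2 + gateExp v.2.1 w.1 v.1

/-- A shift of the last register by `3`, `4` or `5`. -/
def G0Shift (v w : G0Vertex) : Prop :=
  w.1 = v.1 ∧ w.2.1 = v.2.1 ∧
    (w.2.2 = v.2.2 + 3 ∨ w.2.2 = v.2.2 + 4 ∨ w.2.2 = v.2.2 + 5)

theorem add_const_symm (a b : ZMod 8) (h : b = a + 3 ∨ b = a + 4 ∨ b = a + 5) :
    a = b + 3 ∨ a = b + 4 ∨ a = b + 5 := by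
  revert a b; decide

theorem ne_add_const (a : ZMod 8) : a ≠ a + 1 ∧ a ≠ a + 3 ∧ a ≠ a + 4 ∧ a ≠ a + 5 := by
  revert a; decide

/-- The simple 128-vertex graph `g₀`. -/
def g0 : SimpleGraph G0Vertex where
  Adj v w := G0Step v w ∨ G0Step w v ∨ G0Shift v w
  symm := ⟨by
    rintro v w (h | h | ⟨h1, h2, h3⟩)
    · exact Or.inr (Or.inl h)
    · exact Or.inl h
    · exact Or.inr (Or.inr ⟨h1.symm, h2.symm, add_const_symm _ _ h3⟩)⟩
  loopless := ⟨by
    rintro v (h | h | ⟨_, _, h | h | h⟩)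
    · exact (ne_add_const _).1 h.1
    · exact (ne_add_const _).1 h.1
    · exact (ne_add_const _).2.1 h
    · exact (ne_add_const _).2.2.1 h
    · exact (ne_add_const _).2.2.2 h⟩

open Classical in
/-- `A(g₀)`. -/
def adjG0 : Matrix G0Vertex G0Vertex ℂ := g0.adjMatrix ℂ

/-- `e₁ = -1 - 3√2`, the smallest eigenvalue of `A(g₀)`. -/
def e1 : ℝ := -1 - 3 * Real.sqrt 2

/-! ### Gate diagrams and gate graphs -/

/-- The unitary label of a diagram element: `1`, `H` or `HT`. -/
inductive UnitaryLabel where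
  | one
  | H
  | HT

/-- The values `t` such that the nodes `(0, t)`, `(1, t)` appear in a diagram element. -/
def UnitaryLabel.times : UnitaryLabel → Set (ZMod 8)
  | .one => {1, 3, 5, 7}
  | .H => {1, 3, 2, 8}
  | .HT => {1, 3, 4, 6}

/-- Labels `(q, z, t)` of nodes. -/
abbrev Node (R : ℕ) : Type := Fin R × Fin 2 × ZMod 8

/-- A gate diagram with `R` diagram elements: self-loops and edges are attached to nodes that appear
in the diagram elements, and no node has more than one self-loop or edge. -/
structure GateDiagram (R : ℕ) where
  label : Fin R → UnitaryLabel
  loops : Finset (Node R)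
  edges : Finset (Sym2 (Node R))
  loops_appear : ∀ n ∈ loops, n.2.2 ∈ (label n.1).times
  edges_appear : ∀ e ∈ edges, ∀ n ∈ e, n.2.2 ∈ (label n.1).times
  edges_not_diag : ∀ e ∈ edges, ¬ e.IsDiag
  loop_not_edge : ∀ n ∈ loops, ∀ e ∈ edges, n ∉ e
  edge_unique : ∀ e ∈ edges, ∀ e' ∈ edges, ∀ n, n ∈ e → n ∈ e' → e = e'

/-- Vertices `(q, z, t, j)` of a gate graph. -/
abbrev Vertex (R : ℕ) : Type := Fin R × G0Vertex

/-- The node `(q, z, t)` of a vertex `(q, z, t, j)`. -/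
def Vertex.node {R : ℕ} (v : Vertex R) : Node R := (v.1, v.2.1, v.2.2.1)

namespace GateDiagram

variable {R : ℕ} (D : GateDiagram R)

open Classical in
/-- `h_S = ∑_{n ∈ S} |n⟩⟨n| ⊗ 1_j`. -/
def hS : Matrix (Vertex R) (Vertex R) ℂ :=
  Matrix.diagonal fun v => if Vertex.node v ∈ D.loops then 1 else 0

open Classical in
/-- `h_E = ∑_{{n, n'} ∈ E} (|n⟩ + |n'⟩)(⟨n| + ⟨n'|) ⊗ 1_j`. -/
def hE : Matrix (Vertex R) (Vertex R) ℂ :=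
  ∑ e ∈ D.edges, Matrix.of fun v w =>
    if Vertex.node v ∈ e ∧ Vertex.node w ∈ e ∧ v.2.2.2 = w.2.2.2 then 1 else 0

/-- `A(G) = 1_q ⊗ A(g₀) + h_S + h_E` for the gate graph `G` of the diagram. -/
def adj : Matrix (Vertex R) (Vertex R) ℂ :=
  (1 : Matrix (Fin R) (Fin R) ℂ) ⊗ₖ adjG0 + D.hS + D.hE

/-- The gate graph is an `e₁`-gate graph: the smallest eigenvalue of `A(G)` is `e₁`. -/
def IsE1GateGraph : Prop := IsLeast (eigenvalues D.adj) e1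

/-- The set of vertices whose node has neither a self-loop nor an edge. -/
def noLoop : Set (Vertex R) :=
  {v | Vertex.node v ∉ D.loops ∧ ∀ n, s(Vertex.node v, n) ∉ D.edges}

open Classical in
/-- The projector `Π_𝒩`. -/
def projNoLoop : Matrix (Vertex R) (Vertex R) ℂ :=
  Matrix.diagonal fun v => if v ∈ D.noLoop then 1 else 0

/-- `Π₊ = ½ (|0⟩ + |1⟩)(⟨0| + ⟨1|)`. -/
def projPlus : Matrix (Fin 2) (Fin 2) ℂ := (1 / 2 : ℂ) • !![1, 1; 1, 1]

/-- `A(G^SL) = A(G) ⊗ 1_d + 2 Π_𝒩 ⊗ Π₊`. -/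
def adjSL : Matrix (Vertex R × Fin 2) (Vertex R × Fin 2) ℂ :=
  D.adj ⊗ₖ (1 : Matrix (Fin 2) (Fin 2) ℂ) + (2 : ℂ) • (D.projNoLoop ⊗ₖ projPlus)

end GateDiagram

end BoseHubbard

end

/-!
The antisymmetric lift `φ ⊗ (|0⟩ - |1⟩)^{⊗N}` of a state of `G` is annihilated by every `Π₊`, so it
keeps its kinetic energy in `G^SL`, while spreading each vertex over two reduces the interaction.
Hence the ground energy does not increase.

For the lower bound, `A(G) + 2 Π_𝒩 ≥ e₁ + 1/128`: the low-energy states of `g₀` have nearly the same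
weight at all times, and each diagram element has a time at which no node appears, where `2 Π_𝒩`
costs energy. So every zero-energy state of the kinetic part of `G^SL` is an antisymmetric lift,
whose interaction energy is bounded below by the ground energy of `G`. A ground state of `G^SL` is
split into its part in that kernel and the rest, and the spectral gap bounds the norm of the rest by
its kinetic energy.
-/

noncomputable section

namespace BoseHubbard

open Matrix Function
open scoped ComplexOrder

/-! ### Quadratic forms and eigenvalues -/

section QuadForm

variable {ι : Type*} [Fintype ι]

/-- The squared Euclidean norm of a vector; the norm that the type `ι → ℂ` carries is the sup
norm. -/
def normSq (v : ι → ℂ) : ℝ := ∑ i, ‖v i‖ ^ 2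

/-- The quadratic form `⟨v, M v⟩` of a Hermitian matrix, as a real number. -/
def quadForm (M : Matrix ι ι ℂ) (v : ι → ℂ) : ℝ := (star v ⬝ᵥ M *ᵥ v).re

theorem normSq_nonneg (v : ι → ℂ) : 0 ≤ normSq v := Finset.sum_nonneg fun _ _ => by positivity

theorem normSq_pos {v : ι → ℂ} (hv : v ≠ 0) : 0 < normSq v := by
  obtain ⟨i, hi⟩ := Function.ne_iff.mp hv
  exact Finset.sum_pos' (fun _ _ => by positivity)
    ⟨i, Finset.mem_univ _, by have := norm_pos_iff.mpr hi; positivity⟩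

theorem star_dotProduct_self (v : ι → ℂ) : star v ⬝ᵥ v = (normSq v : ℂ) := by
  simp [dotProduct, normSq, Complex.conj_mul']

theorem sum_mul_norm_sq_le {d : ι → ℝ} (hd : ∀ i, 0 ≤ d i) (v w : ι → ℂ) :
    ∑ i, d i * ‖v i‖ ^ 2 ≤ 2 * ∑ i, d i * ‖w i‖ ^ 2 + 2 * ∑ i, d i * ‖(v - w) i‖ ^ 2 := by
  simp only [Finset.mul_sum, ← Finset.sum_add_distrib]
  refine Finset.sum_le_sum fun i _ => ?_
  have h : ‖v i‖ ^ 2 ≤ 2 * (‖w i‖ ^ 2 + ‖(v - w) i‖ ^ 2) :=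
    calc ‖v i‖ ^ 2 = ‖w i + (v - w) i‖ ^ 2 := by simp
      _ ≤ (‖w i‖ + ‖(v - w) i‖) ^ 2 := by gcongr; exact norm_add_le _ _
      _ ≤ 2 * (‖w i‖ ^ 2 + ‖(v - w) i‖ ^ 2) := add_sq_le
  nlinarith [mul_le_mul_of_nonneg_left h (hd i)]

theorem normSq_le_add_sub (v w : ι → ℂ) : normSq v ≤ 2 * normSq w + 2 * normSq (v - w) := by
  simpa [normSq] using sum_mul_norm_sq_le (fun _ => zero_le_one) v w

theorem quadForm_add (M M' : Matrix ι ι ℂ) (v : ι → ℂ) :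
    quadForm (M + M') v = quadForm M v + quadForm M' v := by
  simp [quadForm, add_mulVec, dotProduct_add]

theorem quadForm_smul (c : ℝ) (M : Matrix ι ι ℂ) (v : ι → ℂ) :
    quadForm ((c : ℂ) • M) v = c * quadForm M v := by
  simp [quadForm, smul_mulVec, dotProduct_smul]

theorem quadForm_one [DecidableEq ι] (v : ι → ℂ) : quadForm 1 v = normSq v := by
  simp [quadForm, star_dotProduct_self]

theorem quadForm_sub_smul_one [DecidableEq ι] (M : Matrix ι ι ℂ) (c : ℝ) (v : ι → ℂ) :
    quadForm (M - (c : ℂ) • 1) v = quadForm M v - c * normSq v := by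
  rw [eq_sub_iff_add_eq, ← quadForm_one, ← quadForm_smul, ← quadForm_add, sub_add_cancel]

theorem quadForm_of_mulVec_eq {M : Matrix ι ι ℂ} {v : ι → ℂ} {x : ℝ}
    (h : M *ᵥ v = (x : ℂ) • v) : quadForm M v = x * normSq v := by
  simp [quadForm, h, star_dotProduct_self, dotProduct_smul]

theorem quadForm_diagonal [DecidableEq ι] (d : ι → ℝ) (v : ι → ℂ) :
    quadForm (diagonal fun i => (d i : ℂ)) v = ∑ i, d i * ‖v i‖ ^ 2 := by
  simp only [quadForm, dotProduct, mulVec_diagonal, Complex.re_sum]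
  refine Finset.sum_congr rfl fun i _ => ?_
  rw [Pi.star_apply, RCLike.star_def, mul_left_comm, Complex.conj_mul', ← Complex.ofReal_pow,
    ← Complex.ofReal_mul, Complex.ofReal_re]

theorem quadForm_nonneg {M : Matrix ι ι ℂ} (hM : M.PosSemidef) (v : ι → ℂ) : 0 ≤ quadForm M v :=
  hM.re_dotProduct_nonneg v

end QuadForm

section Eigenvalues

variable {ι : Type*} [Fintype ι]

theorem exists_hasEigenvalue_forall_mul_le {E : Type*} [NormedAddCommGroup E]
    [InnerProductSpace ℂ E] [FiniteDimensional ℂ E] [Nontrivial E] {T : E →ₗ[ℂ] E}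
    (hT : T.IsSymmetric) :
    ∃ m : ℝ, Module.End.HasEigenvalue T (m : ℂ) ∧ ∀ x, m * ‖x‖ ^ 2 ≤ (inner ℂ x (T x)).re := by
  refine ⟨_, hT.hasEigenvalue_iInf_of_finiteDimensional, fun x => ?_⟩
  obtain rfl | hx := eq_or_ne x 0
  · simp
  have hbdd : BddBelow (Set.range fun x : { x : E // x ≠ 0 } =>
      RCLike.re (inner ℂ (T x) (x : E)) / ‖(x : E)‖ ^ 2) :=
    ⟨-‖T.toContinuousLinearMap‖, Set.forall_mem_range.mpr fun x =>
      (abs_le.mp (T.toContinuousLinearMap.rayleighQuotient_le_norm x)).1⟩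
  rw [← hT x x, ← le_div_iff₀ (pow_pos (norm_pos_iff.mpr hx) 2)]
  exact ciInf_le hbdd ⟨x, hx⟩

variable {M : Matrix ι ι ℂ} {Z : Submodule ℂ (ι → ℂ)}

theorem exists_isLeast_eigenvaluesOn (hM : M.IsHermitian) (hZ : ∀ v ∈ Z, M *ᵥ v ∈ Z)
    (hne : ∃ v ∈ Z, v ≠ 0) :
    ∃ m, IsLeast (eigenvaluesOn M Z) m ∧ ∀ v ∈ Z, m * normSq v ≤ quadForm M v := by
  classical
  let e := WithLp.linearEquiv 2 ℂ (ι → ℂ)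
  let Z' : Submodule ℂ (EuclideanSpace ℂ ι) := Z.comap e.toLinearMap
  let T : Z' →ₗ[ℂ] Z' := (toEuclideanLin M).restrict (p := Z') (q := Z') fun v hv => hZ _ hv
  have hT : LinearMap.IsSymmetric (𝕜 := ℂ) (E := Z') T :=
    (isSymmetric_toEuclideanLin_iff.mpr hM).restrict_invariant (V := Z') fun v hv => hZ _ hv
  have : Nontrivial Z' := by
    obtain ⟨v, hv, hv0⟩ := hne
    exact ⟨⟨⟨e.symm v, by simpa [Z'] using hv⟩, 0, fun h => hv0 (by
      simpa using congrArg (fun w : Z' => e w) h)⟩⟩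
  obtain ⟨m, hev, hmin⟩ := exists_hasEigenvalue_forall_mul_le hT
  have hray : ∀ v ∈ Z, m * normSq v ≤ quadForm M v := by
    intro v hv
    have := hmin ⟨e.symm v, by simpa [Z'] using hv⟩
    rwa [Submodule.coe_inner, EuclideanSpace.inner_eq_star_dotProduct, dotProduct_comm,
      Submodule.coe_norm, EuclideanSpace.norm_sq_eq] at this
  obtain ⟨w, hw⟩ := hev.exists_hasEigenvector
  refine ⟨m, ⟨⟨e w, w.2, fun h => hw.2 ?_, ?_⟩, ?_⟩, hray⟩
  · exact Subtype.ext (e.injective (by simpa using h))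
  · exact congrArg (fun w : Z' => e w) hw.apply_eq_smul
  · rintro x ⟨v, hv, hv0, hx⟩
    have := hray v hv
    rw [quadForm_of_mulVec_eq hx] at this
    exact le_of_mul_le_mul_right this (normSq_pos hv0)

theorem isLeast_sInf_eigenvaluesOn (hM : M.IsHermitian) (hZ : ∀ v ∈ Z, M *ᵥ v ∈ Z)
    (hne : ∃ v ∈ Z, v ≠ 0) : IsLeast (eigenvaluesOn M Z) (sInf (eigenvaluesOn M Z)) := by
  obtain ⟨m, hm, -⟩ := exists_isLeast_eigenvaluesOn hM hZ hne
  rwa [hm.csInf_eq]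

theorem sInf_eigenvaluesOn_mul_normSq_le (hM : M.IsHermitian) (hZ : ∀ v ∈ Z, M *ᵥ v ∈ Z)
    {v : ι → ℂ} (hv : v ∈ Z) : sInf (eigenvaluesOn M Z) * normSq v ≤ quadForm M v := by
  obtain rfl | hv0 := eq_or_ne v 0
  · simp [normSq, quadForm]
  obtain ⟨m, hm, hray⟩ := exists_isLeast_eigenvaluesOn hM hZ ⟨v, hv, hv0⟩
  rw [hm.csInf_eq]
  exact hray v hv

theorem isLeast_minEigenvalue [Nonempty ι] (hM : M.IsHermitian) :
    IsLeast (eigenvalues M) (minEigenvalue M) :=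
  isLeast_sInf_eigenvaluesOn hM (fun _ _ => trivial) ⟨1, trivial, one_ne_zero⟩

theorem nonneg_of_mem_eigenvalues (hM : M.PosSemidef) {x : ℝ} (hx : x ∈ eigenvalues M) :
    0 ≤ x := by
  obtain ⟨v, -, hv0, hv⟩ := hx
  have := quadForm_nonneg hM v
  rw [quadForm_of_mulVec_eq hv] at this
  exact nonneg_of_mul_nonneg_left this (normSq_pos hv0)

theorem gap_nonneg (hM : M.PosSemidef) : 0 ≤ gap M :=
  Real.sInf_nonneg fun _ hx => nonneg_of_mem_eigenvalues hM hx.1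

theorem gap_le (hM : M.PosSemidef) {x : ℝ} (hx : x ∈ eigenvalues M) (hx0 : x ≠ 0) : gap M ≤ x :=
  csInf_le ⟨0, fun _ hy => nonneg_of_mem_eigenvalues hM hy.1⟩ ⟨hx, hx0⟩

variable [DecidableEq ι]

theorem posSemidef_sub_minEigenvalue (hM : M.IsHermitian) :
    (M - (minEigenvalue M : ℂ) • 1).PosSemidef := by
  have hherm : (M - (minEigenvalue M : ℂ) • 1).IsHermitian :=
    hM.sub (isHermitian_one.smul (by simp [IsSelfAdjoint]))
  refine .of_dotProduct_mulVec_nonneg hherm fun v => ?_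
  rw [Complex.nonneg_iff]
  refine ⟨?_, (hherm.im_star_dotProduct_mulVec_self v).symm⟩
  have := sInf_eigenvaluesOn_mul_normSq_le (Z := ⊤) hM (fun _ _ => trivial) (v := v) trivial
  rw [← quadForm, quadForm_sub_smul_one]
  exact sub_nonneg.mpr this

theorem mem_eigenvalues_sub_smul_one {c x : ℝ} :
    x ∈ eigenvalues (M - (c : ℂ) • 1) ↔ x + c ∈ eigenvalues M := by
  simp only [eigenvalues, eigenvaluesOn, Set.mem_ofPred_eq, sub_mulVec, smul_mulVec, one_mulVec,
    sub_eq_iff_eq_add, Complex.ofReal_add, add_smul]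

theorem eigenvalues_mem_eigenvalues (hM : M.IsHermitian) (a : ι) :
    hM.eigenvalues a ∈ eigenvalues M :=
  ⟨hM.eigenvectorBasis a, trivial, fun h => hM.eigenvectorBasis.orthonormal.ne_zero a
    (WithLp.ofLp_injective 2 h), by rw [hM.mulVec_eigenvectorBasis]; ext; simp⟩

end Eigenvalues

/-! ### Operators on many registers -/

section ProductOp

variable {V : Type*} {N : ℕ}

/-- The tensor product `M₁ ⊗ ⋯ ⊗ M_N` of one-register operators. -/
def productOp (M : Fin N → Matrix V V ℂ) : Matrix (Fin N → V) (Fin N → V) ℂ :=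
  Matrix.of fun x y => ∏ i, M i (x i) (y i)

theorem conjTranspose_productOp (M : Fin N → Matrix V V ℂ) :
    (productOp M)ᴴ = productOp fun i => (M i)ᴴ := by
  ext x y
  simp [productOp, conjTranspose_apply]

theorem productOp_mul [Fintype V] (M M' : Fin N → Matrix V V ℂ) :
    productOp M * productOp M' = productOp fun i => M i * M' i := by
  ext x y
  simp only [productOp, mul_apply, of_apply, Finset.prod_univ_sum, Fintype.piFinset_univ,
    Finset.prod_mul_distrib]

variable [DecidableEq V]

theorem productOp_diagonal (d : Fin N → V → ℂ) :
    productOp (fun i => diagonal (d i)) = diagonal fun x => ∏ i, d i (x i) := by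
  ext x y
  simp only [productOp, of_apply, diagonal_apply]
  split_ifs with h
  · simp [h]
  · obtain ⟨i, hi⟩ := Function.ne_iff.mp h
    exact Finset.prod_eq_zero (Finset.mem_univ i) (if_neg hi)

theorem productOp_one : productOp (fun _ : Fin N => (1 : Matrix V V ℂ)) = 1 := by
  simpa using productOp_diagonal (fun (_ : Fin N) (_ : V) => (1 : ℂ))

theorem productOp_mem_unitaryGroup [Fintype V] {U : Matrix V V ℂ} (hU : U ∈ unitaryGroup V ℂ) :
    (productOp fun _ => U) ∈ unitaryGroup (Fin N → V) ℂ := by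
  rw [mem_unitaryGroup_iff, star_eq_conjTranspose, conjTranspose_productOp, productOp_mul,
    ← star_eq_conjTranspose, mem_unitaryGroup_iff.mp hU, productOp_one]

theorem productOp_conj_diagonal [Fintype V] (U : Matrix V V ℂ) (d : V → ℂ) :
    (productOp fun _ : Fin N => U * diagonal d * Uᴴ) =
      (productOp fun _ => U) * (diagonal fun x => ∏ i, d (x i)) * (productOp fun _ => U)ᴴ := by
  rw [← productOp_diagonal fun _ => d, conjTranspose_productOp, productOp_mul, productOp_mul]

end ProductOp

section OnRegister

variable {V : Type*} [DecidableEq V] {N : ℕ}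

theorem onRegister_eq_productOp (M : Matrix V V ℂ) (i : Fin N) :
    onRegister N M i = productOp (update (fun _ => 1) i M) := by
  ext x y
  simp only [onRegister, productOp, of_apply]
  rw [← Finset.mul_prod_erase _ _ (Finset.mem_univ i)]
  split_ifs with h
  · rw [Finset.prod_eq_one]
    · simp
    · intro j hj
      simp [update_of_ne (Finset.ne_of_mem_erase hj), h j (Finset.ne_of_mem_erase hj)]
  · push Not at h
    obtain ⟨j, hj, hxy⟩ := h
    rw [Finset.prod_eq_zero (Finset.mem_erase.mpr ⟨hj, Finset.mem_univ j⟩), mul_zero]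
    simp [update_of_ne hj, hxy]

theorem conjTranspose_onRegister (M : Matrix V V ℂ) (i : Fin N) :
    (onRegister N M i)ᴴ = onRegister N Mᴴ i := by
  ext x y
  simp only [onRegister, conjTranspose_apply, of_apply, apply_ite star, star_zero, eq_comm]

theorem onRegister_diagonal (d : V → ℂ) (i : Fin N) :
    onRegister N (diagonal d) i = diagonal fun x => d (x i) := by
  ext x y
  have h : x = y ↔ (∀ j, j ≠ i → x j = y j) ∧ x i = y i :=
    ⟨fun h => by simp [h], fun h => funext fun j => if hj : j = i then hj ▸ h.2 else h.1 j hj⟩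
  simp only [onRegister, of_apply, diagonal_apply, h, ite_and]

theorem onRegister_sub (M M' : Matrix V V ℂ) (i : Fin N) :
    onRegister N (M - M') i = onRegister N M i - onRegister N M' i := by
  ext x y
  simp only [onRegister, of_apply, Matrix.sub_apply]
  split_ifs <;> simp

theorem onRegister_smul_one (c : ℂ) (i : Fin N) :
    onRegister N (c • (1 : Matrix V V ℂ)) i = c • 1 := by
  simp only [smul_one_eq_diagonal, onRegister_diagonal]

theorem onRegister_conj_diagonal [Fintype V] {U : Matrix V V ℂ} (hU : U ∈ unitaryGroup V ℂ)
    (d : V → ℂ) (i : Fin N) :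
    onRegister N (U * diagonal d * Uᴴ) i =
      (productOp fun _ => U) * (diagonal fun x => d (x i)) * (productOp fun _ => U)ᴴ := by
  have hU' : U * Uᴴ = 1 := mem_unitaryGroup_iff.mp hU
  rw [← onRegister_diagonal, onRegister_eq_productOp, onRegister_eq_productOp,
    conjTranspose_productOp, productOp_mul, productOp_mul]
  congr 1
  funext j
  obtain rfl | hj := eq_or_ne j i
  · simp
  · simp [update_of_ne hj, hU']

variable [Fintype V]

theorem onRegister_mulVec (M : Matrix V V ℂ) (i : Fin N) (f : (Fin N → V) → ℂ) (x : Fin N → V) :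
    (onRegister N M i *ᵥ f) x = (M *ᵥ fun a => f (update x i a)) (x i) := by
  have hsupp : Finset.univ.filter (fun y : Fin N → V => ∀ j, j ≠ i → x j = y j) =
      Finset.univ.image (update x i) := by
    ext y
    simp only [Finset.mem_filter, Finset.mem_univ, true_and, Finset.mem_image]
    exact ⟨fun h => ⟨y i, (eq_update_iff.mpr ⟨rfl, fun j hj => (h j hj).symm⟩).symm⟩,
      fun ⟨a, ha⟩ j hj => by rw [← ha, update_of_ne hj]⟩
  simp only [mulVec, dotProduct, onRegister, of_apply, ite_mul, zero_mul]
  rw [← Finset.sum_filter, hsupp, Finset.sum_image (update_injective x i).injOn]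
  simp

theorem onRegister_mulVec_eq_zero_iff {M : Matrix V V ℂ} {i : Fin N} {f : (Fin N → V) → ℂ} :
    onRegister N M i *ᵥ f = 0 ↔ ∀ x, (M *ᵥ fun a => f (update x i a)) = 0 := by
  refine ⟨fun h x => funext fun a => ?_, fun h => funext fun x => ?_⟩
  · simpa [onRegister_mulVec] using congrFun h (update x i a)
  · rw [onRegister_mulVec, h, Pi.zero_apply, Pi.zero_apply]

/-- The energy of `f` under the sum `∑ᵢ K^{(i)}` of one-particle operators. -/
def kineticEnergy (K : Matrix V V ℂ) (f : (Fin N → V) → ℂ) : ℝ :=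
  quadForm (∑ i, onRegister N K i) f

theorem kineticEnergy_eq_zero {K : Matrix V V ℂ} {f : (Fin N → V) → ℂ}
    (h : ∀ i, onRegister N K i *ᵥ f = 0) : kineticEnergy K f = 0 := by
  simp [kineticEnergy, quadForm, sum_mulVec, h]

end OnRegister

/-! ### Permutation symmetry -/

section Permutations

variable {V : Type*} {N : ℕ}

/-- An operator on `N` registers that commutes with every permutation of the registers. -/
def IsPermInvariant (M : Matrix (Fin N → V) (Fin N → V) ℂ) : Prop :=
  ∀ (p : Equiv.Perm (Fin N)) (x y), M (x ∘ p) (y ∘ p) = M x y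

theorem isPermInvariant_productOp (M : Matrix V V ℂ) :
    IsPermInvariant (productOp fun _ : Fin N => M) := fun p x y =>
  Equiv.prod_comp p fun i => M (x i) (y i)

variable [DecidableEq V]

theorem isPermInvariant_diagonal {d : (Fin N → V) → ℂ}
    (hd : ∀ (p : Equiv.Perm (Fin N)) (x), d (x ∘ p) = d x) : IsPermInvariant (diagonal d) := by
  intro p x y
  simp only [diagonal_apply, hd, p.surjective.injective_comp_right.eq_iff]

theorem isPermInvariant_sum_onRegister (M : Matrix V V ℂ) :
    IsPermInvariant (∑ i : Fin N, onRegister N M i) := by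
  intro p x y
  have hreg (i : Fin N) : onRegister N M i (x ∘ p) (y ∘ p) = onRegister N M (p i) x y := by
    simp only [onRegister, of_apply, Function.comp_apply,
      p.forall_congr_left (p := fun j => j ≠ i → _), Equiv.apply_symm_apply, ne_eq,
      Equiv.symm_apply_eq]
  simp only [Matrix.sum_apply, hreg]
  exact Equiv.sum_comp p fun i => onRegister N M i x y

theorem factorial_smul_eq_sum_symState [Fintype V] {f : (Fin N → V) → ℂ}
    (hf : ∀ (p : Equiv.Perm (Fin N)) (x), f (x ∘ p) = f x) :
    (N.factorial : ℂ) • f = ∑ x, (f x * (Real.sqrt N.factorial : ℂ)) • symState N x := by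
  have hfac : (Real.sqrt N.factorial : ℂ) ≠ 0 := by
    exact_mod_cast (Real.sqrt_pos.mpr (by exact_mod_cast N.factorial_pos)).ne'
  have hperm (p : Equiv.Perm (Fin N)) : ∑ x, f x • Pi.single (x ∘ p) (1 : ℂ) = f := by
    calc ∑ x, f x • Pi.single (x ∘ p) (1 : ℂ) = ∑ y, f y • Pi.single y (1 : ℂ) :=
          Fintype.sum_equiv (p.symm.arrowCongr (.refl V)) _ _ fun x => by
            rw [show p.symm.arrowCongr (.refl V) x = x ∘ p from rfl, hf]
      _ = f := by simpa [Pi.single_apply, funext_iff, eq_comm] using (pi_eq_sum_univ f).symm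
  simp only [symState, Complex.ofReal_div, Complex.ofReal_one, smul_smul, mul_assoc,
    mul_one_div_cancel hfac, mul_one, Finset.smul_sum]
  rw [Finset.sum_comm, Finset.sum_congr rfl fun p _ => hperm p, Finset.sum_const,
    Finset.card_univ, Fintype.card_perm, Fintype.card_fin, Nat.cast_smul_eq_nsmul]

theorem mem_bosonicSpace_iff [Finite V] {f : (Fin N → V) → ℂ} :
    f ∈ bosonicSpace V N ↔ ∀ (p : Equiv.Perm (Fin N)) (x), f (x ∘ p) = f x := by
  refine ⟨fun hf => ?_, fun hf => ?_⟩
  · induction hf using Submodule.span_induction with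
    | mem f hf =>
      obtain ⟨y, rfl⟩ := hf
      intro p x
      simp only [symState, Pi.smul_apply, Finset.sum_apply]
      congr 1
      refine Fintype.sum_equiv (Equiv.mulRight p⁻¹) _ _ fun q => ?_
      have : x ∘ p = y ∘ q ↔ x = y ∘ q ∘ p.symm :=
        ⟨fun h => by rw [← comp_assoc, ← h, comp_assoc, p.self_comp_symm, comp_id],
          fun h => by rw [h, comp_assoc, comp_assoc, p.symm_comp_self, comp_id]⟩
      simp only [Pi.single_apply, this]
      rfl
    | zero => simp
    | add f g _ _ hf hg => intro p x; simp [hf p x, hg p x]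
    | smul c f _ hf => intro p x; simp [hf p x]
  · have := Fintype.ofFinite V
    have hN : (N.factorial : ℂ) ≠ 0 := Nat.cast_ne_zero.mpr N.factorial_ne_zero
    rw [← Submodule.smul_mem_iff _ hN, factorial_smul_eq_sum_symState hf]
    exact Submodule.sum_mem _ fun x _ => Submodule.smul_mem _ _ (Submodule.subset_span ⟨x, rfl⟩)

theorem IsPermInvariant.mulVec_mem_bosonicSpace [Fintype V] {M : Matrix (Fin N → V) (Fin N → V) ℂ}
    (hM : IsPermInvariant M) {f : (Fin N → V) → ℂ} (hf : f ∈ bosonicSpace V N) :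
    M *ᵥ f ∈ bosonicSpace V N := by
  rw [mem_bosonicSpace_iff] at hf ⊢
  intro p x
  refine (Fintype.sum_equiv (p.symm.arrowCongr (.refl V)) _ _ fun y => ?_).symm
  change M x y * f y = M (x ∘ p) (y ∘ p) * f (y ∘ p)
  rw [hM, hf]

end Permutations

/-! ### The spectral gap of the kinetic energy -/

section KernelProjection

theorem normSq_mulVec_of_mem_unitaryGroup {ι : Type*} [Fintype ι] [DecidableEq ι]
    {W : Matrix ι ι ℂ} (hW : W ∈ unitaryGroup ι ℂ) (w : ι → ℂ) : normSq (W *ᵥ w) = normSq w := by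
  have hW' : Wᴴ * W = 1 := mem_unitaryGroup_iff'.mp hW
  rw [← Complex.ofReal_inj, ← star_dotProduct_self, ← star_dotProduct_self, star_mulVec,
    ← dotProduct_mulVec, mulVec_mulVec, hW', one_mulVec]

theorem quadForm_conj {ι κ : Type*} [Fintype ι] [Fintype κ] (U : Matrix ι κ ℂ) (M : Matrix κ κ ℂ)
    (v : ι → ℂ) : quadForm (U * M * Uᴴ) v = quadForm M (Uᴴ *ᵥ v) := by
  rw [quadForm, quadForm, star_mulVec, conjTranspose_conjTranspose, ← mulVec_mulVec,
    ← mulVec_mulVec, dotProduct_mulVec]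

theorem mul_normSq_conj_diagonal_mulVec_le {ι : Type*} [Fintype ι] [DecidableEq ι]
    {W : Matrix ι ι ℂ} (hW : W ∈ unitaryGroup ι ℂ) {g : ℝ} {d e : ι → ℝ}
    (h : ∀ i, g * d i ^ 2 ≤ e i) (f : ι → ℂ) :
    g * normSq ((W * (diagonal fun i => (d i : ℂ)) * Wᴴ) *ᵥ f) ≤
      quadForm (W * (diagonal fun i => (e i : ℂ)) * Wᴴ) f := by
  rw [quadForm_conj, quadForm_diagonal, ← mulVec_mulVec, ← mulVec_mulVec,
    normSq_mulVec_of_mem_unitaryGroup hW, normSq, Finset.mul_sum]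
  refine Finset.sum_le_sum fun i _ => ?_
  rw [mulVec_diagonal, norm_mul, mul_pow, Complex.norm_real, Real.norm_eq_abs, sq_abs, ← mul_assoc]
  exact mul_le_mul_of_nonneg_right (h i) (sq_nonneg _)

theorem conj_diagonal_mul_conj_diagonal {ι : Type*} [Fintype ι] [DecidableEq ι]
    {W : Matrix ι ι ℂ} (hW : W ∈ unitaryGroup ι ℂ) (d e : ι → ℂ) :
    W * diagonal d * Wᴴ * (W * diagonal e * Wᴴ) = W * (diagonal fun i => d i * e i) * Wᴴ := by
  have hW' : Wᴴ * W = 1 := mem_unitaryGroup_iff'.mp hW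
  calc W * diagonal d * Wᴴ * (W * diagonal e * Wᴴ)
      = W * (diagonal d * ((Wᴴ * W) * diagonal e)) * Wᴴ := by simp only [Matrix.mul_assoc]
    _ = W * (diagonal fun i => d i * e i) * Wᴴ := by
      rw [hW', Matrix.one_mul, diagonal_mul_diagonal]

theorem mul_sub_le_sum_of_forall_ne_zero_le {V : Type*} {N : ℕ} {k : V → ℝ}
    (hk : ∀ a, 0 ≤ k a) {g : ℝ} (hg : ∀ a, k a ≠ 0 → g ≤ k a) (x : Fin N → V) :
    g * (1 - ∏ i, if k (x i) = 0 then 1 else 0) ^ 2 ≤ ∑ i, k (x i) := by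
  have hsum (i : Fin N) : k (x i) ≤ ∑ i, k (x i) :=
    Finset.single_le_sum (fun j _ => hk (x j)) (Finset.mem_univ i)
  rw [Finset.prod_ite_zero]
  split_ifs with h
  · simpa using Finset.sum_nonneg fun i _ => hk (x i)
  · push Not at h
    obtain ⟨i, -, hi⟩ := h
    simpa using (hg _ hi).trans (hsum i)

variable {V : Type*} [Fintype V] [DecidableEq V] {K : Matrix V V ℂ}

theorem onRegister_eq_conj_diagonal (hK : K.IsHermitian) {N : ℕ} (i : Fin N) :
    onRegister N K i = (productOp fun _ => (hK.eigenvectorUnitary : Matrix V V ℂ)) *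
      (diagonal fun x => (hK.eigenvalues (x i) : ℂ)) *
        (productOp fun _ => (hK.eigenvectorUnitary : Matrix V V ℂ))ᴴ := by
  rw [← onRegister_conj_diagonal hK.eigenvectorUnitary.2 fun a => (hK.eigenvalues a : ℂ)]
  congr 1
  conv_lhs => rw [hK.spectral_theorem, Unitary.conjStarAlgAut_apply]
  rfl

theorem exists_kernel_projection (hK : K.PosSemidef) {g : ℝ}
    (hg : ∀ x ∈ eigenvalues K, x ≠ 0 → g ≤ x) (N : ℕ) :
    ∃ Q : Matrix (Fin N → V) (Fin N → V) ℂ, IsPermInvariant Q ∧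
      (∀ i, onRegister N K i * Q = 0) ∧
      ∀ f, g * normSq (f - Q *ᵥ f) ≤ kineticEnergy K f := by
  let k := hK.isHermitian.eigenvalues
  let U : Matrix V V ℂ := hK.isHermitian.eigenvectorUnitary
  let W : Matrix (Fin N → V) (Fin N → V) ℂ := productOp fun _ => U
  have hW : W ∈ unitaryGroup (Fin N → V) ℂ :=
    productOp_mem_unitaryGroup hK.isHermitian.eigenvectorUnitary.2
  have hk (a : V) : k a ∈ eigenvalues K := eigenvalues_mem_eigenvalues hK.isHermitian a
  have hreg (i : Fin N) : onRegister N K i = W * (diagonal fun x => (k (x i) : ℂ)) * Wᴴ :=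
    onRegister_eq_conj_diagonal hK.isHermitian i
  let χ (x : Fin N → V) : ℝ := ∏ i, if k (x i) = 0 then 1 else 0
  have hχ (i : Fin N) (x : Fin N → V) : (k (x i) : ℂ) * χ x = 0 := by
    simp only [χ, Finset.prod_ite_zero]
    split_ifs with h
    · simp [h i (Finset.mem_univ i)]
    · simp
  have hQ : productOp (fun _ : Fin N => U * (diagonal fun a => if k a = 0 then 1 else 0) * Uᴴ) =
      W * (diagonal fun x => (χ x : ℂ)) * Wᴴ := by
    simp [productOp_conj_diagonal, χ, W, apply_ite]
  refine ⟨W * (diagonal fun x => (χ x : ℂ)) * Wᴴ, hQ ▸ isPermInvariant_productOp _,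
    fun i => ?_, fun f => ?_⟩
  · simp [hreg, conj_diagonal_mul_conj_diagonal hW, hχ]
  · have hsub : f - (W * (diagonal fun x => (χ x : ℂ)) * Wᴴ) *ᵥ f =
        (W * (diagonal fun x => ((1 - χ x : ℝ) : ℂ)) * Wᴴ) *ᵥ f := by
      have hW' : W * Wᴴ = 1 := mem_unitaryGroup_iff.mp hW
      simp [← diagonal_sub, mul_sub, sub_mul, hW', sub_mulVec]
    have hkin : ∑ i, onRegister N K i = W * (diagonal fun x => ((∑ i, k (x i) : ℝ) : ℂ)) * Wᴴ := by
      simp only [hreg, ← Finset.sum_mul, ← Finset.mul_sum, Complex.ofReal_sum]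
      congr 2
      ext x y
      simp [Matrix.sum_apply, diagonal_apply]
    rw [hsub, kineticEnergy, hkin]
    exact mul_normSq_conj_diagonal_mulVec_le hW (mul_sub_le_sum_of_forall_ne_zero_le
      (fun a => nonneg_of_mem_eigenvalues hK (hk a)) fun a => hg _ (hk a)) f

theorem kineticEnergy_nonneg (hK : K.PosSemidef) {N : ℕ} (f : (Fin N → V) → ℂ) :
    0 ≤ kineticEnergy K f := by
  obtain ⟨Q, -, -, hQ⟩ := exists_kernel_projection hK
    (fun x hx _ => nonneg_of_mem_eigenvalues hK hx) N
  simpa using hQ f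

end KernelProjection

/-! ### The Hamiltonian and its ground energy -/

section Collisions

variable {V : Type*} [DecidableEq V] {N : ℕ}

/-- The number of ordered pairs of distinct registers that hold the same vertex: the eigenvalue of
`∑_k n̂_k (n̂_k - 1)` on the basis state `|x⟩`. -/
def collisions (x : Fin N → V) : ℝ := ∑ i, ∑ j, if i ≠ j ∧ x i = x j then 1 else 0

theorem collisions_nonneg (x : Fin N → V) : 0 ≤ collisions x :=
  Finset.sum_nonneg fun _ _ => Finset.sum_nonneg fun _ _ => by split_ifs <;> norm_num

theorem collisions_le (x : Fin N → V) : collisions x ≤ (N : ℝ) ^ 2 := by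
  calc collisions x ≤ ∑ _i : Fin N, ∑ _j : Fin N, (1 : ℝ) :=
        Finset.sum_le_sum fun _ _ => Finset.sum_le_sum fun _ _ => by split_ifs <;> norm_num
    _ = (N : ℝ) ^ 2 := by simp [sq]

theorem collisions_comp_perm (x : Fin N → V) (p : Equiv.Perm (Fin N)) :
    collisions (x ∘ p) = collisions x :=
  Fintype.sum_equiv p _ _ fun _ => Fintype.sum_equiv p _ _ fun _ => by simp

theorem sum_ite_mul_sub_one_eq_collisions [Fintype V] (x : Fin N → V) :
    ∑ k, (∑ i, if x i = k then (1 : ℂ) else 0) * ((∑ i, if x i = k then (1 : ℂ) else 0) - 1) =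
      collisions x := by
  have hother (i : Fin N) : (∑ j, if x j = x i then (1 : ℂ) else 0) - 1 =
      ∑ j, if i ≠ j ∧ x i = x j then (1 : ℂ) else 0 := by
    rw [← Finset.add_sum_erase _ _ (Finset.mem_univ i), if_pos rfl, add_sub_cancel_left,
      ← Finset.sum_erase (a := i) Finset.univ (by simp)]
    refine Finset.sum_congr rfl fun j hj => ?_
    simp only [(Finset.ne_of_mem_erase hj).symm, ne_eq, not_false_eq_true, true_and, eq_comm]
  simp only [Finset.sum_mul, ite_mul, one_mul, zero_mul]
  rw [Finset.sum_comm]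
  simp only [Finset.sum_ite_eq, Finset.mem_univ, if_true, hother, collisions,
    Complex.ofReal_sum, apply_ite ((↑) : ℝ → ℂ), Complex.ofReal_one, Complex.ofReal_zero]

theorem numberOp_eq_diagonal (k : V) :
    numberOp N k = diagonal fun x => ∑ i, if x i = k then (1 : ℂ) else 0 := by
  have h : Matrix.single k k (1 : ℂ) = diagonal fun a => if a = k then 1 else 0 := by
    ext a b
    simp only [single_apply, diagonal_apply]
    grind
  simp only [numberOp, h, onRegister_diagonal]
  exact (map_sum (diagonalAddMonoidHom (Fin N → V) ℂ) _ _).symm.trans (congrArg _ (by ext; simp))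

theorem hamiltonian_eq [Fintype V] (A : Matrix V V ℂ) :
    hamiltonian N A = ∑ i, onRegister N A i + diagonal fun x => (collisions x : ℂ) := by
  simp only [hamiltonian, numberOp_eq_diagonal, ← diagonal_one, diagonal_sub,
    diagonal_mul_diagonal, ← sum_ite_mul_sub_one_eq_collisions]
  congr 1
  exact (map_sum (diagonalAddMonoidHom (Fin N → V) ℂ) _ _).symm.trans (congrArg _ (by ext; simp))

theorem hamiltonian_sub_eq [Fintype V] (A : Matrix V V ℂ) (m : ℝ) :
    hamiltonian N A - (((N : ℝ) * m : ℝ) : ℂ) • 1 =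
      ∑ i, onRegister N (A - (m : ℂ) • 1) i + diagonal fun x => (collisions x : ℂ) := by
  simp only [hamiltonian_eq, onRegister_sub, onRegister_smul_one, Finset.sum_sub_distrib,
    Finset.sum_const, Finset.card_univ, Fintype.card_fin]
  rw [← Nat.cast_smul_eq_nsmul ℂ, smul_smul]
  push_cast
  abel

variable [Fintype V]

/-- The expectation of the on-site repulsion `∑_k n̂_k (n̂_k - 1)` in the state `f`. -/
def interactionEnergy (f : (Fin N → V) → ℂ) : ℝ := ∑ x, collisions x * ‖f x‖ ^ 2

theorem interactionEnergy_nonneg (f : (Fin N → V) → ℂ) : 0 ≤ interactionEnergy f :=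
  Finset.sum_nonneg fun x _ => mul_nonneg (collisions_nonneg x) (by positivity)

theorem interactionEnergy_le (f : (Fin N → V) → ℂ) :
    interactionEnergy f ≤ (N : ℝ) ^ 2 * normSq f := by
  rw [normSq, Finset.mul_sum]
  exact Finset.sum_le_sum fun x _ => mul_le_mul_of_nonneg_right (collisions_le x) (by positivity)

theorem quadForm_hamiltonian_sub (A : Matrix V V ℂ) (m : ℝ) (f : (Fin N → V) → ℂ) :
    quadForm (hamiltonian N A - (((N : ℝ) * m : ℝ) : ℂ) • 1) f =
      kineticEnergy (A - (m : ℂ) • 1) f + interactionEnergy f := by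
  rw [hamiltonian_sub_eq, quadForm_add, quadForm_diagonal, kineticEnergy, interactionEnergy]

theorem isHermitian_hamiltonian_sub {A : Matrix V V ℂ} (hA : A.IsHermitian) (m : ℝ) :
    (hamiltonian N A - (m : ℂ) • 1).IsHermitian := by
  rw [hamiltonian_eq]
  refine (IsHermitian.add ?_ ?_).sub ?_
  · exact isSelfAdjoint_sum _ fun i _ => (conjTranspose_onRegister A i).trans (by rw [hA.eq])
  · exact isHermitian_diagonal_of_self_adjoint _ (funext fun x => by simp)
  · exact isHermitian_one.smul (by simp [IsSelfAdjoint])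

theorem isPermInvariant_hamiltonian_sub (A : Matrix V V ℂ) (m : ℝ) :
    IsPermInvariant (hamiltonian N A - (((N : ℝ) * m : ℝ) : ℂ) • 1) := by
  rw [hamiltonian_sub_eq]
  intro p x y
  rw [Matrix.add_apply, Matrix.add_apply, isPermInvariant_sum_onRegister _ p,
    isPermInvariant_diagonal (fun p x => by rw [collisions_comp_perm]) p]

end Collisions

section GroundEnergy

variable {V : Type*} [Fintype V] [DecidableEq V] {A : Matrix V V ℂ} {N : ℕ}

theorem groundEnergy_mul_normSq_le (hA : A.IsHermitian) {f : (Fin N → V) → ℂ}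
    (hf : f ∈ bosonicSpace V N) :
    groundEnergy N A * normSq f ≤
      kineticEnergy (A - (minEigenvalue A : ℂ) • 1) f + interactionEnergy f := by
  rw [← quadForm_hamiltonian_sub]
  exact sInf_eigenvaluesOn_mul_normSq_le (isHermitian_hamiltonian_sub hA _)
    (fun _ => (isPermInvariant_hamiltonian_sub A _).mulVec_mem_bosonicSpace) hf

theorem exists_groundState [Nonempty V] (hA : A.IsHermitian) (N : ℕ) :
    ∃ f ∈ bosonicSpace V N, f ≠ 0 ∧
      groundEnergy N A * normSq f =
        kineticEnergy (A - (minEigenvalue A : ℂ) • 1) f + interactionEnergy f := by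
  obtain ⟨⟨f, hf, hf0, hfe⟩, -⟩ := isLeast_sInf_eigenvaluesOn (Z := bosonicSpace V N)
    (isHermitian_hamiltonian_sub hA (N * minEigenvalue A))
    (fun _ => (isPermInvariant_hamiltonian_sub A _).mulVec_mem_bosonicSpace)
    ⟨1, mem_bosonicSpace_iff.mpr fun _ _ => rfl, one_ne_zero⟩
  exact ⟨f, hf, hf0, by rw [← quadForm_hamiltonian_sub]; exact (quadForm_of_mulVec_eq hfe).symm⟩

theorem groundEnergy_nonneg [Nonempty V] (hA : A.IsHermitian) (N : ℕ) :
    0 ≤ groundEnergy N A := by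
  obtain ⟨f, -, hf0, hf⟩ := exists_groundState hA N
  have hkin := kineticEnergy_nonneg (posSemidef_sub_minEigenvalue hA) f
  have hint := interactionEnergy_nonneg f
  exact nonneg_of_mul_nonneg_left (hf ▸ add_nonneg hkin hint) (normSq_pos hf0)

theorem groundEnergy_mul_normSq_le_interactionEnergy (hA : A.IsHermitian) {f : (Fin N → V) → ℂ}
    (hf : f ∈ bosonicSpace V N)
    (hker : ∀ i, onRegister N (A - (minEigenvalue A : ℂ) • 1) i *ᵥ f = 0) :
    groundEnergy N A * normSq f ≤ interactionEnergy f := by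
  have h := groundEnergy_mul_normSq_le hA hf
  rwa [kineticEnergy_eq_zero hker, zero_add] at h

theorem prod_comp_update {α M : Type*} [CommMonoid M] (g : α → M) (x : Fin N → α) (i : Fin N)
    (a : α) : ∏ j, g (update x i a j) = g a * ∏ j ∈ Finset.univ \ {i}, g (x j) := by
  simpa only [← comp_update, Function.comp_apply] using
    Finset.prod_update_of_mem (Finset.mem_univ i) (g ∘ x) (g a)

theorem onRegister_mulVec_prod_eq_zero {K : Matrix V V ℂ} {v : V → ℂ} (hv : K *ᵥ v = 0)
    (i : Fin N) : onRegister N K i *ᵥ (fun x => ∏ j, v (x j)) = 0 := by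
  refine onRegister_mulVec_eq_zero_iff.mpr fun x => ?_
  have hprod : (fun a => ∏ j, v (update x i a j)) = (∏ j ∈ Finset.univ \ {i}, v (x j)) • v := by
    funext a
    rw [prod_comp_update, mul_comm, Pi.smul_apply, smul_eq_mul]
  rw [hprod, mulVec_smul, hv, smul_zero]

theorem groundEnergy_le [Nonempty V] (hA : A.IsHermitian) (N : ℕ) :
    groundEnergy N A ≤ (N : ℝ) ^ 2 := by
  obtain ⟨⟨v, -, hv0, hv⟩, -⟩ := isLeast_minEigenvalue hA
  obtain ⟨a, ha⟩ := Function.ne_iff.mp hv0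
  set f : (Fin N → V) → ℂ := fun x => ∏ i, v (x i)
  have hf0 : f ≠ 0 := fun h => pow_ne_zero N ha (by simpa [f] using congrFun h fun _ => a)
  have hf : f ∈ bosonicSpace V N :=
    mem_bosonicSpace_iff.mpr fun p x => Equiv.prod_comp p fun i => v (x i)
  have hker : (A - (minEigenvalue A : ℂ) • 1) *ᵥ v = 0 := by simp [sub_mulVec, smul_mulVec, hv]
  refine le_of_mul_le_mul_right ?_ (normSq_pos hf0)
  exact (groundEnergy_mul_normSq_le_interactionEnergy hA hf
    (onRegister_mulVec_prod_eq_zero hker)).trans (interactionEnergy_le f)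

end GroundEnergy

/-! ### Doubling a graph -/

section Doubling

variable {V : Type*} {A P : Matrix V V ℂ}

/-- Two copies of the graph with adjacency matrix `A`, in which states symmetric under the exchange
of the copies are penalized by `2 P`; the construction of `G^SL` for arbitrary matrices. -/
def doubling (A P : Matrix V V ℂ) : Matrix (V × Fin 2) (V × Fin 2) ℂ :=
  A ⊗ₖ (1 : Matrix (Fin 2) (Fin 2) ℂ) + (2 : ℂ) • (P ⊗ₖ GateDiagram.projPlus)

theorem doubling_sub_smul_one [DecidableEq V] (A P : Matrix V V ℂ) (c : ℂ) :
    doubling A P - c • 1 = doubling (A - c • 1) P := by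
  rw [doubling, doubling, ← one_kronecker_one, ← smul_kronecker c, add_sub_right_comm]
  congr 1
  ext a b
  simp only [Matrix.sub_apply, kroneckerMap_apply, sub_mul]

theorem projPlus_apply (a b : Fin 2) : GateDiagram.projPlus a b = 1 / 2 := by
  fin_cases a <;> fin_cases b <;> simp [GateDiagram.projPlus]

theorem posSemidef_projPlus : GateDiagram.projPlus.PosSemidef := by
  have h : GateDiagram.projPlus = (1 / 2 : ℂ) • vecMulVec 1 (star 1) := by
    ext a b
    simp [projPlus_apply]
  rw [h]
  exact (posSemidef_vecMulVec_self_star _).smul (by positivity)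

theorem isHermitian_doubling (hA : A.IsHermitian) (hP : P.IsHermitian) :
    (doubling A P).IsHermitian := by
  rw [IsHermitian, doubling, conjTranspose_add, conjTranspose_smul, conjTranspose_kronecker,
    conjTranspose_kronecker, hA.eq, hP.eq, posSemidef_projPlus.isHermitian.eq, conjTranspose_one,
    Complex.star_def, Complex.conj_ofNat]

theorem posSemidef_doubling [Finite V] (hA : A.PosSemidef) (hP : P.PosSemidef) :
    (doubling A P).PosSemidef :=
  (hA.kronecker .one).add ((hP.kronecker posSemidef_projPlus).smul zero_le_two)

variable [Fintype V]

theorem doubling_mulVec (A P : Matrix V V ℂ) (v : V × Fin 2 → ℂ) (a : V) (d : Fin 2) :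
    (doubling A P *ᵥ v) (a, d) =
      (A *ᵥ fun b => v (b, d)) a + (P *ᵥ fun b => v (b, 0) + v (b, 1)) a := by
  simp only [doubling, add_mulVec, smul_mulVec, Pi.add_apply, Pi.smul_apply]
  congr 1
  · simp [mulVec, dotProduct, Fintype.sum_prod_type, Matrix.one_apply]
  · simp only [mulVec, dotProduct, Fintype.sum_prod_type, kroneckerMap_apply, projPlus_apply,
      Fin.sum_univ_two, smul_eq_mul, Finset.mul_sum]
    exact Finset.sum_congr rfl fun b _ => by ring

theorem doubling_mulVec_antisymm (A P : Matrix V V ℂ) (v : V → ℂ) (a : V × Fin 2) :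
    (doubling A P *ᵥ fun b => (-1) ^ (b.2 : ℕ) * v b.1) a =
      (-1) ^ (a.2 : ℕ) * (A *ᵥ v) a.1 := by
  have hsmul : (fun b => (-1 : ℂ) ^ (a.2 : ℕ) * v b) = (-1 : ℂ) ^ (a.2 : ℕ) • v := rfl
  have hzero : (fun b => (-1 : ℂ) ^ ((0 : Fin 2) : ℕ) * v b + (-1) ^ ((1 : Fin 2) : ℕ) * v b) =
      0 := by
    funext b
    simp
  rw [← Prod.mk.eta (p := a), doubling_mulVec, hzero, hsmul, mulVec_zero, mulVec_smul]
  simp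

theorem le_or_antisymm_of_doubling_mulVec_eq {c : ℝ}
    (hc : ∀ s, c * normSq s ≤ quadForm (A + (2 : ℂ) • P) s) {v : V × Fin 2 → ℂ} {x : ℝ}
    (hv : doubling A P *ᵥ v = (x : ℂ) • v) :
    c ≤ x ∨ (∀ a, v (a, 1) = -v (a, 0)) ∧
      (A *ᵥ fun a => v (a, 0)) = (x : ℂ) • fun a => v (a, 0) := by
  set s : V → ℂ := fun a => v (a, 0) + v (a, 1) with hs
  have hd (d : Fin 2) (a : V) : (A *ᵥ fun b => v (b, d)) a + (P *ᵥ s) a = x * v (a, d) := by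
    rw [← doubling_mulVec, hv, Pi.smul_apply, smul_eq_mul]
  obtain h0 | h0 := eq_or_ne s 0
  · refine .inr ⟨fun a => eq_neg_of_add_eq_zero_right (congrFun h0 a), funext fun a => ?_⟩
    simpa [h0] using hd 0 a
  · have hsx : (A + (2 : ℂ) • P) *ᵥ s = (x : ℂ) • s := by
      have hAs : A *ᵥ s = (A *ᵥ fun a => v (a, 0)) + A *ᵥ fun a => v (a, 1) := by
        rw [← mulVec_add]
        rfl
      funext a
      simp only [add_mulVec, smul_mulVec, hAs, Pi.add_apply, Pi.smul_apply, smul_eq_mul]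
      rw [hs]
      linear_combination hd 0 a + hd 1 a
    have h := hc s
    rw [quadForm_of_mulVec_eq hsx] at h
    exact .inl (le_of_mul_le_mul_right h (normSq_pos h0))

theorem mem_eigenvalues_doubling {x : ℝ} (hx : x ∈ eigenvalues A) (P : Matrix V V ℂ) :
    x ∈ eigenvalues (doubling A P) := by
  obtain ⟨v, -, hv0, hv⟩ := hx
  refine ⟨fun a => (-1) ^ (a.2 : ℕ) * v a.1, trivial, fun h => hv0 (funext fun a => ?_),
    funext fun a => ?_⟩
  · simpa using congrFun h (a, 0)
  · rw [doubling_mulVec_antisymm, hv]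
    simp only [Pi.smul_apply, smul_eq_mul]
    ring

theorem le_or_mem_eigenvalues_of_mem_eigenvalues_doubling {c : ℝ}
    (hc : ∀ s, c * normSq s ≤ quadForm (A + (2 : ℂ) • P) s) {x : ℝ}
    (hx : x ∈ eigenvalues (doubling A P)) : c ≤ x ∨ x ∈ eigenvalues A := by
  obtain ⟨v, -, hv0, hv⟩ := hx
  refine (le_or_antisymm_of_doubling_mulVec_eq hc hv).imp_right fun ⟨hanti, hA⟩ =>
    ⟨_, trivial, fun h => hv0 (funext fun ⟨a, d⟩ => ?_), hA⟩
  have ha : v (a, 0) = 0 := congrFun h a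
  fin_cases d
  · exact ha
  · exact (hanti a).trans (by simp [ha])

theorem min_gap_le_of_mem_eigenvalues_doubling (hA : A.PosSemidef) {c : ℝ}
    (hc : ∀ s, c * normSq s ≤ quadForm (A + (2 : ℂ) • P) s) {x : ℝ}
    (hx : x ∈ eigenvalues (doubling A P)) (hx0 : x ≠ 0) : min (gap A) c ≤ x :=
  (le_or_mem_eigenvalues_of_mem_eigenvalues_doubling hc hx).elim
    (min_le_right _ _).trans fun h => (min_le_left _ _).trans (gap_le hA h hx0)

theorem minEigenvalue_doubling [Nonempty V] (hA : A.IsHermitian) (hP : P.PosSemidef) :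
    minEigenvalue (doubling A P) = minEigenvalue A := by
  classical
  refine IsLeast.csInf_eq ⟨mem_eigenvalues_doubling (isLeast_minEigenvalue hA).1 P, fun x hx => ?_⟩
  rw [← sub_nonneg]
  refine nonneg_of_mem_eigenvalues
    (posSemidef_doubling (posSemidef_sub_minEigenvalue hA) hP) ?_
  rw [← doubling_sub_smul_one, mem_eigenvalues_sub_smul_one, sub_add_cancel]
  exact hx

end Doubling

/-! ### The antisymmetric lift -/

section AntisymLift

variable {V : Type*} {N : ℕ}

/-- The state `φ ⊗ (|0⟩ - |1⟩)^{⊗N}`. -/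
def antisymLift (φ : (Fin N → V) → ℂ) (X : Fin N → V × Fin 2) : ℂ :=
  (∏ i, (-1) ^ ((X i).2 : ℕ)) * φ fun i => (X i).1

theorem norm_antisymLift (φ : (Fin N → V) → ℂ) (X : Fin N → V × Fin 2) :
    ‖antisymLift φ X‖ = ‖φ fun i => (X i).1‖ := by
  simp [antisymLift, norm_prod]

theorem antisymLift_update (φ : (Fin N → V) → ℂ) (X : Fin N → V × Fin 2)
    (i : Fin N) (a : V × Fin 2) :
    antisymLift φ (update X i a) = (∏ j ∈ Finset.univ \ {i}, (-1) ^ ((X j).2 : ℕ)) *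
      ((-1) ^ (a.2 : ℕ) * φ (update (fun j => (X j).1) i a.1)) := by
  have hfst : (fun j => (update X i a j).1) = update (fun j => (X j).1) i a.1 :=
    comp_update Prod.fst X i a
  rw [antisymLift, hfst, prod_comp_update fun b : V × Fin 2 => (-1 : ℂ) ^ (b.2 : ℕ)]
  ring

theorem eq_of_forall_update_eq {ι α β : Type*} [Finite ι] [DecidableEq ι] {F : (ι → α) → β}
    {X Y : ι → α} (h : ∀ i Z, F (update Z i (X i)) = F (update Z i (Y i))) : F X = F Y := by
  cases nonempty_fintype ι
  have hpw (s : Finset ι) : F (s.piecewise X Y) = F Y := by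
    induction s using Finset.induction_on with
    | empty => simp
    | insert i s hi ih =>
      rw [Finset.piecewise_insert, h, ← ih,
        update_eq_self_iff.mpr (Finset.piecewise_eq_of_notMem s X Y hi).symm]
  simpa using hpw Finset.univ

theorem eq_antisymLift_of_forall_update {u : (Fin N → V × Fin 2) → ℂ}
    (hu : ∀ X i a, u (update X i (a, 1)) = -u (update X i (a, 0))) :
    u = antisymLift fun x => u fun i => (x i, 0) := by
  funext X
  have hconst : (∏ i, (-1) ^ ((X i).2 : ℕ)) * u X = u fun i => ((X i).1, 0) := by
    have h := eq_of_forall_update_eq (X := X) (Y := fun i => ((X i).1, 0))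
      (F := fun X => (∏ i, (-1) ^ ((X i).2 : ℕ)) * u X) fun i Z => by
        simp only [prod_comp_update fun b : V × Fin 2 => (-1 : ℂ) ^ (b.2 : ℕ)]
        obtain ⟨a, d⟩ := X i
        fin_cases d
        · rfl
        · simp [hu]
    simpa using h
  rw [antisymLift, ← hconst, ← mul_assoc, ← Finset.prod_mul_distrib]
  simp [← pow_add]

theorem antisymLift_mem_bosonicSpace [Finite V] [DecidableEq V] {φ : (Fin N → V) → ℂ}
    (hφ : φ ∈ bosonicSpace V N) : antisymLift φ ∈ bosonicSpace (V × Fin 2) N := by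
  rw [mem_bosonicSpace_iff] at hφ ⊢
  intro p X
  exact congrArg₂ (· * ·) (Equiv.prod_comp p fun i => (-1 : ℂ) ^ ((X i).2 : ℕ))
    (hφ p fun i => (X i).1)

variable [Fintype V]

theorem sum_comp_fst {β : Type*} [AddCommMonoid β] (F : (Fin N → V) → (Fin N → Fin 2) → β) :
    ∑ X : Fin N → V × Fin 2, F (fun i => (X i).1) (fun i => (X i).2) = ∑ x, ∑ d, F x d := by
  rw [← Fintype.sum_prod_type']
  exact Fintype.sum_equiv (Equiv.arrowProdEquivProdArrow _ _ _) _ _ fun X => rfl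

theorem star_antisymLift_dotProduct (φ ψ : (Fin N → V) → ℂ) :
    star (antisymLift φ) ⬝ᵥ antisymLift ψ = 2 ^ N * (star φ ⬝ᵥ ψ) := by
  have hsign (X : Fin N → V × Fin 2) : star (antisymLift φ) X * antisymLift ψ X =
      star (φ fun i => (X i).1) * ψ fun i => (X i).1 := by
    have h : (∏ i, (-1 : ℂ) ^ ((X i).2 : ℕ)) * ∏ i, (-1 : ℂ) ^ ((X i).2 : ℕ) = 1 := by
      rw [← Finset.prod_mul_distrib]
      simp [← pow_add]
    simp only [Pi.star_apply, antisymLift, star_mul', star_prod, star_pow, star_neg, star_one]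
    linear_combination (star (φ fun i => (X i).1) * ψ fun i => (X i).1) * h
  simp only [dotProduct, hsign]
  rw [sum_comp_fst fun x _ => star (φ x) * ψ x]
  simp [Finset.mul_sum]

theorem normSq_antisymLift (φ : (Fin N → V) → ℂ) :
    normSq (antisymLift φ) = 2 ^ N * normSq φ := by
  have h := star_antisymLift_dotProduct φ φ
  rw [star_dotProduct_self, star_dotProduct_self] at h
  exact_mod_cast h

variable [DecidableEq V]

theorem onRegister_doubling_mulVec_antisymLift (K P : Matrix V V ℂ) (φ : (Fin N → V) → ℂ)
    (i : Fin N) :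
    onRegister N (doubling K P) i *ᵥ antisymLift φ = antisymLift (onRegister N K i *ᵥ φ) := by
  funext X
  set σ := ∏ j ∈ Finset.univ \ {i}, (-1 : ℂ) ^ ((X j).2 : ℕ)
  set v : V → ℂ := fun a => φ (update (fun j => (X j).1) i a)
  have hX : (fun a => antisymLift φ (update X i a)) = σ • fun a => (-1) ^ (a.2 : ℕ) * v a.1 :=
    funext fun a => antisymLift_update φ X i a
  have hφX := antisymLift_update (onRegister N K i *ᵥ φ) X i (X i)
  rw [update_eq_self, update_eq_self, onRegister_mulVec] at hφX
  rw [onRegister_mulVec, hX, mulVec_smul, Pi.smul_apply, doubling_mulVec_antisymm, hφX, smul_eq_mul]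

theorem kineticEnergy_antisymLift (K P : Matrix V V ℂ) (φ : (Fin N → V) → ℂ) :
    kineticEnergy (doubling K P) (antisymLift φ) = 2 ^ N * kineticEnergy K φ := by
  have h : star (antisymLift φ) ⬝ᵥ (∑ i, onRegister N (doubling K P) i) *ᵥ antisymLift φ =
      ((2 ^ N : ℝ) : ℂ) * (star φ ⬝ᵥ (∑ i, onRegister N K i) *ᵥ φ) := by
    simp only [sum_mulVec, dotProduct_sum, onRegister_doubling_mulVec_antisymLift,
      star_antisymLift_dotProduct, Finset.mul_sum]
    norm_num
  rw [kineticEnergy, quadForm, h, Complex.re_ofReal_mul]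
  rfl

omit [Fintype V] [DecidableEq V] in
theorem sum_ite_eq_half {i j : Fin N} (hij : i ≠ j) :
    ∑ d : Fin N → Fin 2, (if d i = d j then (1 : ℝ) else 0) = 2 ^ N / 2 := by
  have hzero : ∑ d : Fin N → Fin 2, ((if d i = d j then (1 : ℝ) else 0) - 1 / 2) = 0 := by
    have hflip (a b : Fin 2) : a + 1 = b ↔ a ≠ b := by lia
    have hinv (a : Fin 2) : a + 1 + 1 = a := by lia
    refine Finset.sum_involution (fun d _ => update d i (d i + 1)) (fun d _ => ?_)
      (fun d _ _ h => ?_) (fun _ _ => Finset.mem_univ _) (fun d _ => by simp [hinv])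
    · by_cases hd : d i = d j <;> norm_num [update_of_ne hij.symm, hflip, hd]
    · simpa using congrFun h i
  rw [Finset.sum_sub_distrib] at hzero
  simp only [Finset.sum_const, Finset.card_univ, Fintype.card_pi_const, Fintype.card_fin,
    nsmul_eq_mul] at hzero
  push_cast at hzero
  linarith

omit [Fintype V] in
theorem two_mul_sum_collisions (x : Fin N → V) :
    2 * ∑ d : Fin N → Fin 2, collisions (fun i => (x i, d i)) = 2 ^ N * collisions x := by
  simp only [collisions]
  rw [Finset.sum_comm, Finset.mul_sum, Finset.mul_sum]
  refine Finset.sum_congr rfl fun i _ => ?_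
  rw [Finset.sum_comm, Finset.mul_sum, Finset.mul_sum]
  refine Finset.sum_congr rfl fun j _ => ?_
  by_cases h : i ≠ j ∧ x i = x j
  · simp only [Prod.mk.injEq, h.1, h.2, ne_eq, not_false_eq_true, true_and, if_true,
      sum_ite_eq_half h.1]
    ring
  · simp only [Prod.mk.injEq, ← and_assoc, h, false_and, if_false, Finset.sum_const_zero, mul_zero]

theorem two_mul_interactionEnergy_antisymLift (φ : (Fin N → V) → ℂ) :
    2 * interactionEnergy (antisymLift φ) = 2 ^ N * interactionEnergy φ := by
  simp only [interactionEnergy, norm_antisymLift]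
  rw [sum_comp_fst fun x d => collisions (fun i => (x i, d i)) * ‖φ x‖ ^ 2, Finset.mul_sum,
    Finset.mul_sum]
  refine Finset.sum_congr rfl fun x _ => ?_
  rw [← Finset.sum_mul, ← mul_assoc, two_mul_sum_collisions, mul_assoc]

theorem exists_eq_antisymLift {K P : Matrix V V ℂ} {c : ℝ} (hc0 : 0 < c)
    (hc : ∀ s, c * normSq s ≤ quadForm (K + (2 : ℂ) • P) s) {u : (Fin N → V × Fin 2) → ℂ}
    (hu : u ∈ bosonicSpace (V × Fin 2) N) (hker : ∀ i, onRegister N (doubling K P) i *ᵥ u = 0) :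
    ∃ φ ∈ bosonicSpace V N, u = antisymLift φ ∧ ∀ i, onRegister N K i *ᵥ φ = 0 := by
  have hslice (X : Fin N → V × Fin 2) (i : Fin N) :
      (∀ a, u (update X i (a, 1)) = -u (update X i (a, 0))) ∧
        (K *ᵥ fun a => u (update X i (a, 0))) = 0 := by
    have h0 := onRegister_mulVec_eq_zero_iff.mp (hker i) X
    simpa [hc0.not_ge] using le_or_antisymm_of_doubling_mulVec_eq hc (x := 0) (by simpa using h0)
  refine ⟨fun x => u fun i => (x i, 0), ?_,
    eq_antisymLift_of_forall_update fun X i => (hslice X i).1, fun i => ?_⟩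
  · rw [mem_bosonicSpace_iff] at hu ⊢
    exact fun p x => hu p fun i => (x i, 0)
  · refine onRegister_mulVec_eq_zero_iff.mpr fun x => ?_
    have hupd (a : V) : (fun j => (update x i a j, (0 : Fin 2))) =
        update (fun j => (x j, 0)) i (a, 0) := comp_update (fun b : V => (b, (0 : Fin 2))) x i a
    simpa only [hupd] using (hslice (fun j => (x j, 0)) i).2

end AntisymLift

/-! ### Ground energy of a doubled graph -/

section Bounds

variable {V : Type*} [Fintype V] [DecidableEq V] {A P : Matrix V V ℂ} {N : ℕ}

theorem groundEnergy_doubling_le [Nonempty V] (hA : A.IsHermitian) (hP : P.PosSemidef) (N : ℕ) :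
    groundEnergy N (doubling A P) ≤ groundEnergy N A := by
  obtain ⟨φ, hφ, hφ0, hgs⟩ := exists_groundState hA N
  have hpos : 0 < 2 ^ N * normSq φ := by have := normSq_pos hφ0; positivity
  have hint : interactionEnergy (antisymLift φ) ≤ 2 ^ N * interactionEnergy φ := by
    linarith [two_mul_interactionEnergy_antisymLift φ, interactionEnergy_nonneg (antisymLift φ)]
  refine le_of_mul_le_mul_right ?_ hpos
  calc groundEnergy N (doubling A P) * (2 ^ N * normSq φ)
      = groundEnergy N (doubling A P) * normSq (antisymLift φ) := by rw [normSq_antisymLift]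
    _ ≤ kineticEnergy (doubling (A - (minEigenvalue A : ℂ) • 1) P) (antisymLift φ) +
          interactionEnergy (antisymLift φ) := by
        rw [← doubling_sub_smul_one, ← minEigenvalue_doubling hA hP]
        exact groundEnergy_mul_normSq_le (isHermitian_doubling hA hP.isHermitian)
          (antisymLift_mem_bosonicSpace hφ)
    _ ≤ 2 ^ N * kineticEnergy (A - (minEigenvalue A : ℂ) • 1) φ + 2 ^ N * interactionEnergy φ := by
        rw [kineticEnergy_antisymLift]
        gcongr
    _ = groundEnergy N A * (2 ^ N * normSq φ) := by rw [← mul_add, ← hgs]; ring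

theorem groundEnergy_mul_normSq_le_of_kernel (hA : A.IsHermitian) {c : ℝ} (hc0 : 0 < c)
    (hc : ∀ s, c * normSq s ≤ quadForm (A - (minEigenvalue A : ℂ) • 1 + (2 : ℂ) • P) s)
    {u : (Fin N → V × Fin 2) → ℂ} (hu : u ∈ bosonicSpace (V × Fin 2) N)
    (hker : ∀ i, onRegister N (doubling (A - (minEigenvalue A : ℂ) • 1) P) i *ᵥ u = 0) :
    groundEnergy N A * normSq u ≤ 2 * interactionEnergy u := by
  obtain ⟨φ, hφ, rfl, hφker⟩ := exists_eq_antisymLift hc0 hc hu hker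
  rw [two_mul_interactionEnergy_antisymLift, normSq_antisymLift, mul_left_comm]
  gcongr
  exact groundEnergy_mul_normSq_le_interactionEnergy hA hφ hφker

theorem groundEnergy_mul_normSq_le_of_sub_kernel [Nonempty V] (hA : A.IsHermitian)
    {ψ u : (Fin N → V × Fin 2) → ℂ} (hu : groundEnergy N A * normSq u ≤ 2 * interactionEnergy u) :
    groundEnergy N A * normSq ψ ≤
      8 * interactionEnergy ψ + 10 * ((N : ℝ) ^ 2 * normSq (ψ - u)) := by
  have hcomm : normSq (u - ψ) = normSq (ψ - u) := by simp only [normSq, Pi.sub_apply, norm_sub_rev]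
  have hint : interactionEnergy u ≤ 2 * interactionEnergy ψ + 2 * interactionEnergy (u - ψ) :=
    sum_mul_norm_sq_le collisions_nonneg u ψ
  have hdiff := interactionEnergy_le (u - ψ)
  rw [hcomm] at hdiff
  have hnorm := mul_le_mul_of_nonneg_left (normSq_le_add_sub ψ u) (groundEnergy_nonneg hA N)
  have hE := mul_le_mul_of_nonneg_right (groundEnergy_le hA N) (normSq_nonneg (ψ - u))
  linarith

theorem min_gap_mul_groundEnergy_le [Nonempty V] (hA : A.IsHermitian) (hP : P.PosSemidef) {c : ℝ}
    (hc0 : 0 < c) (hc1 : c ≤ 1)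
    (hc : ∀ s, c * normSq s ≤ quadForm (A - (minEigenvalue A : ℂ) • 1 + (2 : ℂ) • P) s) (N : ℕ) :
    min (gap (A - (minEigenvalue A : ℂ) • 1)) c * groundEnergy N A ≤
      10 * (N : ℝ) ^ 2 * groundEnergy N (doubling A P) := by
  obtain rfl | hN := N.eq_zero_or_pos
  · have hzero : groundEnergy 0 A = 0 :=
      le_antisymm (by simpa using groundEnergy_le hA 0) (groundEnergy_nonneg hA 0)
    simp [hzero]
  have hN1 : (1 : ℝ) ≤ (N : ℝ) ^ 2 := one_le_pow₀ (by exact_mod_cast hN)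
  have hK := posSemidef_sub_minEigenvalue hA
  set K := A - (minEigenvalue A : ℂ) • 1
  set g := min (gap K) c
  have hg0 : 0 ≤ g := le_min (gap_nonneg hK) hc0.le
  have hg1 : g ≤ 1 := (min_le_right _ _).trans hc1
  obtain ⟨Q, hQinv, hQker, hQgap⟩ := exists_kernel_projection (posSemidef_doubling hK hP)
    (fun x => min_gap_le_of_mem_eigenvalues_doubling hK hc) N
  obtain ⟨ψ, hψ, hψ0, hgs⟩ := exists_groundState (isHermitian_doubling hA hP.isHermitian) N
  rw [minEigenvalue_doubling hA hP, doubling_sub_smul_one] at hgs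
  have hkernel := groundEnergy_mul_normSq_le_of_kernel hA hc0 hc (hQinv.mulVec_mem_bosonicSpace hψ)
    fun i => by rw [mulVec_mulVec, hQker, zero_mulVec]
  have hint := interactionEnergy_nonneg ψ
  refine le_of_mul_le_mul_right ?_ (normSq_pos hψ0)
  calc g * groundEnergy N A * normSq ψ
      ≤ g * (8 * interactionEnergy ψ + 10 * ((N : ℝ) ^ 2 * normSq (ψ - Q *ᵥ ψ))) := by
        rw [mul_assoc]
        exact mul_le_mul_of_nonneg_left
          (groundEnergy_mul_normSq_le_of_sub_kernel hA hkernel) hg0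
    _ = 8 * (g * interactionEnergy ψ) + 10 * (N : ℝ) ^ 2 * (g * normSq (ψ - Q *ᵥ ψ)) := by ring
    _ ≤ 10 * ((N : ℝ) ^ 2 * interactionEnergy ψ) +
          10 * (N : ℝ) ^ 2 * kineticEnergy (doubling K P) ψ := by
        gcongr
        · norm_num
        · exact hg1.trans hN1
        · exact hQgap ψ
    _ = 10 * (N : ℝ) ^ 2 * groundEnergy N (doubling A P) * normSq ψ := by
        rw [mul_assoc _ (groundEnergy N _), hgs]
        ring

end Bounds

/-! ### Cyclic sums -/

section Cyclic

open ZMod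
open scoped ZMod

variable {n : ℕ} [NeZero n]

theorem norm_stdAddChar (x : ZMod n) : ‖stdAddChar x‖ = 1 := by
  rw [stdAddChar_apply]
  exact Circle.norm_coe _

theorem star_stdAddChar (x : ZMod n) : star (stdAddChar x) = stdAddChar (-x) := by
  rw [stdAddChar_apply, stdAddChar_apply, AddChar.map_neg_eq_inv, Circle.coe_inv_eq_conj,
    Complex.star_def]

theorem sum_stdAddChar_mul_star_dft_mul_dft (a b : ZMod n → ℂ) (c : ZMod n) :
    ∑ k, stdAddChar (-(c * k)) * (star (𝓕 a k) * 𝓕 b k) = n * ∑ j, star (a (j + c)) * b j := by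
  have hk (k : ZMod n) : stdAddChar (-(c * k)) * (star (𝓕 a k) * 𝓕 b k) =
      ∑ j, ∑ i, stdAddChar (k * (i - (j + c))) * (star (a i) * b j) := by
    simp only [dft_apply, smul_eq_mul, star_sum, star_mul', star_stdAddChar, neg_neg]
    rw [Finset.sum_mul_sum, Finset.sum_comm, Finset.mul_sum]
    refine Finset.sum_congr rfl fun j _ => ?_
    rw [Finset.mul_sum]
    refine Finset.sum_congr rfl fun i _ => ?_
    rw [show k * (i - (j + c)) = -(c * k) + i * k + -(j * k) by ring, AddChar.map_add_eq_mul,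
      AddChar.map_add_eq_mul]
    ring
  simp only [hk]
  rw [Finset.sum_comm, Finset.mul_sum]
  refine Finset.sum_congr rfl fun j _ => ?_
  rw [Finset.sum_comm]
  simp only [← Finset.sum_mul, AddChar.sum_mulShift _ (isPrimitive_stdAddChar n), sub_eq_zero,
    ZMod.card, ite_mul, zero_mul, Nat.cast_ite, Nat.cast_zero, Finset.sum_ite_eq',
    Finset.mem_univ, if_true]

theorem normSq_dft (a : ZMod n → ℂ) : normSq (𝓕 a) = n * normSq a := by
  have h := sum_stdAddChar_mul_star_dft_mul_dft a a 0
  simp only [zero_mul, neg_zero, AddChar.map_zero_eq_one, one_mul, add_zero, Complex.star_def,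
    Complex.conj_mul'] at h
  exact_mod_cast h

theorem le_add_sum_of_forall_add_one_le {ν δ : ZMod n → ℝ} (hδ : ∀ t, 0 ≤ δ t)
    (h : ∀ t, ν (t + 1) ≤ ν t + δ t) (t₀ t : ZMod n) : ν t ≤ ν t₀ + ∑ s, δ s := by
  have hsteps (m : ℕ) : ν (t₀ + m) ≤ ν t₀ + ∑ i ∈ Finset.range m, δ (t₀ + i) := by
    induction m with
    | zero => simp
    | succ m ih =>
      rw [Finset.sum_range_succ, Nat.cast_succ, ← add_assoc, ← add_assoc]
      exact (h _).trans (add_le_add_left ih _)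
  have hinj : Set.InjOn (fun i : ℕ => t₀ + (i : ZMod n)) (Finset.range (t - t₀).val) :=
    fun i hi j hj hij => CharP.natCast_injOn_Iio (ZMod n) n
      ((Finset.mem_range.mp hi).trans (val_lt _)) ((Finset.mem_range.mp hj).trans (val_lt _))
      (add_left_cancel hij)
  calc ν t = ν (t₀ + (t - t₀).val) := by rw [natCast_zmod_val, add_sub_cancel]
    _ ≤ ν t₀ + ∑ i ∈ Finset.range (t - t₀).val, δ (t₀ + i) := hsteps _
    _ ≤ ν t₀ + ∑ s, δ s := by
      rw [← Finset.sum_image (f := δ) hinj]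
      gcongr
      · exact fun s _ _ => hδ s
      · exact Finset.subset_univ _

theorem sum_sq_le_of_forall_add_one_le {ν δ : ZMod n → ℝ} (hν : ∀ t, 0 ≤ ν t) (hδ : ∀ t, 0 ≤ δ t)
    (h : ∀ t, ν (t + 1) ≤ ν t + δ t) (t₀ : ZMod n) :
    ∑ t, ν t ^ 2 ≤ 2 * n * ν t₀ ^ 2 + 2 * n ^ 2 * ∑ t, δ t ^ 2 := by
  have hcs : (∑ s, δ s) ^ 2 ≤ n * ∑ s, δ s ^ 2 := by
    simpa using sq_sum_le_card_mul_sum_sq (s := Finset.univ) (f := δ)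
  calc ∑ t, ν t ^ 2 ≤ ∑ _t : ZMod n, 2 * (ν t₀ ^ 2 + n * ∑ s, δ s ^ 2) :=
        Finset.sum_le_sum fun t _ =>
          (pow_le_pow_left₀ (hν t) (le_add_sum_of_forall_add_one_le hδ h t₀ t) 2).trans
            (add_sq_le.trans (by gcongr))
    _ = 2 * n * ν t₀ ^ 2 + 2 * n ^ 2 * ∑ t, δ t ^ 2 := by
        rw [Finset.sum_const, Finset.card_univ, ZMod.card, nsmul_eq_mul]
        ring

end Cyclic

/-! ### The graph `g₀` at fixed momentum -/

section Momentum

open ZMod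

theorem normSq_add_smul {ι : Type*} [Fintype ι] (v w : ι → ℂ) (s : ℝ) :
    normSq (v + (s : ℂ) • w) = normSq v + 2 * s * (star v ⬝ᵥ w).re + s ^ 2 * normSq w := by
  simp only [normSq, dotProduct, Complex.re_sum, Finset.mul_sum, ← Finset.sum_add_distrib]
  refine Finset.sum_congr rfl fun i _ => ?_
  simp only [← Complex.normSq_eq_norm_sq, Complex.normSq_apply, Pi.add_apply, Pi.smul_apply,
    smul_eq_mul, Complex.add_re, Complex.add_im, Complex.mul_re, Complex.mul_im,
    Complex.ofReal_re, Complex.ofReal_im, Pi.star_apply, RCLike.star_def, Complex.conj_re,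
    Complex.conj_im]
  ring

theorem normSq_smul {ι : Type*} [Fintype ι] (s : ℝ) (v : ι → ℂ) :
    normSq ((s : ℂ) • v) = s ^ 2 * normSq v := by
  simp [normSq, mul_pow, Finset.mul_sum]

theorem sqrt_normSq_sub_le {ι : Type*} [Fintype ι] (v w : ι → ℂ) :
    √(normSq (v - w)) ≤ √(normSq v) + √(normSq w) := by
  simpa [EuclideanSpace.norm_eq, normSq] using norm_sub_le (WithLp.toLp 2 v) (WithLp.toLp 2 w)

theorem normSq_mulVec_le_of_norm_apply_le_one {ι κ : Type*} [Fintype ι] [Fintype κ]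
    {M : Matrix ι κ ℂ} (hM : ∀ i j, ‖M i j‖ ≤ 1) (v : κ → ℂ) :
    normSq (M *ᵥ v) ≤ Fintype.card ι * Fintype.card κ * normSq v := by
  have hrow (i : ι) : ‖(M *ᵥ v) i‖ ^ 2 ≤ Fintype.card κ * normSq v := by
    calc ‖(M *ᵥ v) i‖ ^ 2 ≤ (∑ j, ‖v j‖) ^ 2 := by
          gcongr
          refine (norm_sum_le _ _).trans (Finset.sum_le_sum fun j _ => ?_)
          rw [norm_mul]
          exact mul_le_of_le_one_left (norm_nonneg _) (hM i j)
      _ ≤ Fintype.card κ * normSq v := sq_sum_le_card_mul_sum_sq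
  calc normSq (M *ᵥ v) ≤ ∑ _i : ι, Fintype.card κ * normSq v :=
        Finset.sum_le_sum fun i _ => hrow i
    _ = Fintype.card ι * Fintype.card κ * normSq v := by simp [mul_assoc]

theorem stdAddChar_four : stdAddChar (4 : ZMod 8) = (-1 : ℂ) := by
  have h := stdAddChar_coe (N := 8) 4
  rw [show (2 * Real.pi * Complex.I * (4 : ℤ) / (8 : ℕ) : ℂ) = Real.pi * Complex.I by
    push_cast; ring, Complex.exp_pi_mul_I] at h
  exact_mod_cast h

theorem re_stdAddChar_one : (stdAddChar (1 : ZMod 8)).re = √2 / 2 := by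
  have h := stdAddChar_coe (N := 8) 1
  rw [show (2 * Real.pi * Complex.I * (1 : ℤ) / (8 : ℕ) : ℂ) = (Real.pi / 4 : ℝ) * Complex.I by
    push_cast; ring, Int.cast_one] at h
  rw [h, Complex.exp_ofReal_mul_I_re, Real.cos_pi_div_four]

theorem re_stdAddChar_neg (x : ZMod 8) : (stdAddChar (-x)).re = (stdAddChar x).re := by
  rw [← star_stdAddChar, Complex.star_def, Complex.conj_re]

/-- The eigenvalue of `S³ + S⁴ + S⁵` on the `k`-th Fourier mode. -/
def shiftEnergy (k : ZMod 8) : ℝ :=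
  (stdAddChar (-(3 * k)) + stdAddChar (-(4 * k)) + stdAddChar (-(5 * k))).re

theorem shiftEnergy_eq (k : ZMod 8) :
    shiftEnergy k = 2 * (stdAddChar (3 * k)).re + (stdAddChar (4 * k)).re := by
  have h5 : -(5 * k) = 3 * k := by revert k; decide
  rw [shiftEnergy, Complex.add_re, Complex.add_re, h5, re_stdAddChar_neg, re_stdAddChar_neg]
  ring

theorem shiftEnergy_of_eq {k : ZMod 8} (hk : k = 1 ∨ k = 7) : shiftEnergy k = -1 - √2 := by
  have h3 : 3 * k = 1 + 4 ∨ 3 * k = -1 + 4 := by revert k; decide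
  have h4 : 4 * k = 4 := by revert k; decide
  rw [shiftEnergy_eq, h4, stdAddChar_four]
  obtain h3 | h3 := h3 <;>
    simp [h3, AddChar.map_add_eq_mul, stdAddChar_four, re_stdAddChar_neg, re_stdAddChar_one] <;>
    ring

theorem neg_one_le_shiftEnergy {k : ZMod 8} (hk : ¬(k = 1 ∨ k = 7)) : -1 ≤ shiftEnergy k := by
  rw [shiftEnergy_eq]
  have hcases : 4 * k = 0 ∨ 4 * k = 4 ∧ (3 * k = 1 ∨ 3 * k = -1) := by revert k; decide
  obtain h4 | ⟨h4, h3⟩ := hcases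
  · have hre := (abs_le.mp (Complex.abs_re_le_norm (stdAddChar (3 * k)))).1
    rw [norm_stdAddChar] at hre
    rw [h4, AddChar.map_zero_eq_one, Complex.one_re]
    linarith
  · have hre : (stdAddChar (3 * k)).re = √2 / 2 := by
      obtain h3 | h3 := h3 <;> simp only [h3, re_stdAddChar_neg, re_stdAddChar_one]
    rw [h4, stdAddChar_four, hre, Complex.neg_re, Complex.one_re]
    linarith [Real.sqrt_nonneg 2]

/-- The gate `B(Uₜ)` on the `k`-th Fourier mode of the register `j`. At `k = ±1` it is `-√2` times
`Uₜ` or its complex conjugate. -/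
def hop (k t : ZMod 8) : Matrix (Fin 2) (Fin 2) ℂ :=
  Matrix.of fun z' z => stdAddChar (-(gateExp t z' z * k))

theorem gateExp_one_one (t : ZMod 8) :
    gateExp t 1 1 = gateExp t 1 0 + gateExp t 0 1 - gateExp t 0 0 + 4 := by
  revert t
  decide

theorem normSq_hop_mulVec_le (k t : ZMod 8) (y : Fin 2 → ℂ) :
    normSq (hop k t *ᵥ y) ≤ 4 * normSq y := by
  refine (normSq_mulVec_le_of_norm_apply_le_one (fun _ _ => (norm_stdAddChar _).le) y).trans_eq ?_
  norm_num

theorem normSq_hop_mulVec {k : ZMod 8} (hk : k = 1 ∨ k = 7) (t : ZMod 8) (y : Fin 2 → ℂ) :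
    normSq (hop k t *ᵥ y) = 2 * normSq y := by
  set δ : ℂ := stdAddChar (-((gateExp t 0 1 - gateExp t 0 0) * k)) with hδ
  have h01 : hop k t 0 1 = hop k t 0 0 * δ := by
    rw [hop, of_apply, of_apply, hδ, ← AddChar.map_add_eq_mul]
    congr 1
    ring
  have h11 : hop k t 1 1 = -(hop k t 1 0 * δ) := by
    have h4 : -(4 * k) = 4 := by rcases hk with rfl | rfl <;> decide
    have hexp : -(gateExp t 1 1 * k) =
        -(gateExp t 1 0 * k) + -((gateExp t 0 1 - gateExp t 0 0) * k) + 4 := by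
      rw [gateExp_one_one]
      linear_combination h4
    change stdAddChar (-(gateExp t 1 1 * k)) = -(stdAddChar (-(gateExp t 1 0 * k)) * δ)
    rw [hexp, AddChar.map_add_eq_mul, stdAddChar_four, mul_neg_one, AddChar.map_add_eq_mul]
  have hrow0 : (hop k t *ᵥ y) 0 = hop k t 0 0 * (y 0 + δ * y 1) := by
    simp only [mulVec, dotProduct, Fin.sum_univ_two, h01]
    ring
  have hrow1 : (hop k t *ᵥ y) 1 = hop k t 1 0 * (y 0 - δ * y 1) := by
    simp only [mulVec, dotProduct, Fin.sum_univ_two, h11]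
    ring
  have hnorm (z : Fin 2) : ‖hop k t z 0‖ = 1 := norm_stdAddChar _
  have hδ1 : ‖δ‖ = 1 := norm_stdAddChar _
  have hpar := parallelogram_law_with_norm ℝ (y 0) (δ * y 1)
  rw [norm_mul, hδ1, one_mul] at hpar
  simp only [normSq, Fin.sum_univ_two, hrow0, hrow1, norm_mul, hnorm, one_mul]
  linarith

/-- The expectation of the hopping terms in a state of momentum `k`, given as a sequence of states
of the register `z` indexed by the time. -/
def hopEnergy (k : ZMod 8) (G : ZMod 8 → Fin 2 → ℂ) : ℝ :=
  2 * (∑ t, star (G (t + 1)) ⬝ᵥ hop k t *ᵥ G t).re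

theorem sum_normSq_add_one (G : ZMod 8 → Fin 2 → ℂ) :
    ∑ t, normSq (G (t + 1)) = ∑ t, normSq (G t) :=
  Equiv.sum_comp (Equiv.addRight 1) fun t => normSq (G t)

theorem neg_four_mul_le_hopEnergy (k : ZMod 8) (G : ZMod 8 → Fin 2 → ℂ) :
    -4 * ∑ t, normSq (G t) ≤ hopEnergy k G := by
  have hstep (t : ZMod 8) : -(normSq (G (t + 1)) + normSq (G t)) ≤
      (star (G (t + 1)) ⬝ᵥ hop k t *ᵥ G t).re := by
    have hsq := normSq_add_smul (G (t + 1)) (hop k t *ᵥ G t) (1 / 2)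
    linarith [normSq_hop_mulVec_le k t (G t),
      normSq_nonneg (G (t + 1) + ((1 / 2 : ℝ) : ℂ) • hop k t *ᵥ G t)]
  have hsum := Finset.sum_le_sum fun t (_ : t ∈ Finset.univ) => hstep t
  rw [Finset.sum_neg_distrib, Finset.sum_add_distrib, sum_normSq_add_one] at hsum
  rw [hopEnergy, Complex.re_sum]
  linarith

/-- The amount `‖G_{t+1} - U G_t‖²` by which `G` fails to evolve by the gate `U = -hop k t / √2` at
time `t`. -/
def defect (k : ZMod 8) (G : ZMod 8 → Fin 2 → ℂ) (t : ZMod 8) : ℝ :=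
  normSq (G (t + 1) + ((√2 / 2 : ℝ) : ℂ) • hop k t *ᵥ G t)

theorem hopEnergy_eq {k : ZMod 8} (hk : k = 1 ∨ k = 7) (G : ZMod 8 → Fin 2 → ℂ) :
    hopEnergy k G = √2 * (∑ t, defect k G t - 2 * ∑ t, normSq (G t)) := by
  have hs : √2 ^ 2 = 2 := Real.sq_sqrt zero_le_two
  have hstep (t : ZMod 8) : 2 * (star (G (t + 1)) ⬝ᵥ hop k t *ᵥ G t).re =
      √2 * (defect k G t - normSq (G (t + 1)) - normSq (G t)) := by
    rw [defect, normSq_add_smul, normSq_hop_mulVec hk]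
    linear_combination (-(star (G (t + 1)) ⬝ᵥ hop k t *ᵥ G t).re - √2 / 2 * normSq (G t)) * hs
  rw [hopEnergy, Complex.re_sum, Finset.mul_sum, Finset.sum_congr rfl fun t _ => hstep t,
    ← Finset.mul_sum, Finset.sum_sub_distrib, Finset.sum_sub_distrib, sum_normSq_add_one]
  ring

theorem sum_normSq_le_add_sum_defect {k : ZMod 8} (hk : k = 1 ∨ k = 7) (G : ZMod 8 → Fin 2 → ℂ)
    (t₀ : ZMod 8) : ∑ t, normSq (G t) ≤ 16 * normSq (G t₀) + 128 * ∑ t, defect k G t := by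
  have hs : √2 ^ 2 = 2 := Real.sq_sqrt zero_le_two
  have hstep (t : ZMod 8) : √(normSq (G (t + 1))) ≤ √(normSq (G t)) + √(defect k G t) := by
    have h := sqrt_normSq_sub_le (G (t + 1) + ((√2 / 2 : ℝ) : ℂ) • hop k t *ᵥ G t)
      (((√2 / 2 : ℝ) : ℂ) • hop k t *ᵥ G t)
    have hiso : normSq (((√2 / 2 : ℝ) : ℂ) • hop k t *ᵥ G t) = normSq (G t) := by
      rw [normSq_smul, normSq_hop_mulVec hk]
      linear_combination normSq (G t) / 2 * hs
    rw [add_sub_cancel_right, hiso] at h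
    exact h.trans_eq (add_comm _ _)
  have h := sum_sq_le_of_forall_add_one_le (ν := fun t => √(normSq (G t)))
    (δ := fun t => √(defect k G t)) (fun _ => Real.sqrt_nonneg _) (fun _ => Real.sqrt_nonneg _)
    hstep t₀
  simp only [Real.sq_sqrt (normSq_nonneg _), Nat.cast_ofNat] at h
  simp only [defect, Real.sq_sqrt (normSq_nonneg _)] at h ⊢
  linarith

theorem mul_sum_normSq_le_hopEnergy_add (k : ZMod 8) (G : ZMod 8 → Fin 2 → ℂ) (t₀ : ZMod 8) :
    (e1 + 1 / 128) * ∑ t, normSq (G t) ≤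
      hopEnergy k G + shiftEnergy k * ∑ t, normSq (G t) + 2 * normSq (G t₀) := by
  have hsum : 0 ≤ ∑ t, normSq (G t) := Finset.sum_nonneg fun t _ => normSq_nonneg _
  have h0 := normSq_nonneg (G t₀)
  have hs : (1.414 : ℝ) ≤ √2 := Real.le_sqrt_of_sq_le (by norm_num)
  rw [e1]
  by_cases hk : k = 1 ∨ k = 7
  · have hdef : 0 ≤ ∑ t, defect k G t := Finset.sum_nonneg fun t _ => normSq_nonneg _
    rw [hopEnergy_eq hk, shiftEnergy_of_eq hk]
    nlinarith [sum_normSq_le_add_sum_defect hk G t₀,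
      mul_nonneg (by linarith : 0 ≤ √2 - 1) hdef]
  · nlinarith [neg_four_mul_le_hopEnergy k G,
      mul_le_mul_of_nonneg_right (neg_one_le_shiftEnergy hk) hsum,
      mul_nonneg (by linarith : 0 ≤ √2 - 1.414) hsum]

end Momentum

/-! ### The spectrum of `g₀` -/

section AdjG0

open ZMod
open scoped ZMod

/-- The sum of the terms `|t+1⟩⟨t| ⊗ B(Uₜ)` of `A(g₀)`. -/
def hopMatrix : Matrix G0Vertex G0Vertex ℂ :=
  Matrix.of fun w v =>
    if w.2.1 = v.2.1 + 1 ∧ w.2.2 = v.2.2 + gateExp v.2.1 w.1 v.1 then 1 else 0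

/-- The term `1 ⊗ 1 ⊗ (S³ + S⁴ + S⁵)` of `A(g₀)`. -/
def shiftMatrix : Matrix G0Vertex G0Vertex ℂ :=
  Matrix.of fun w v =>
    if w.1 = v.1 ∧ w.2.1 = v.2.1 ∧
      (w.2.2 = v.2.2 + 3 ∨ w.2.2 = v.2.2 + 4 ∨ w.2.2 = v.2.2 + 5) then 1 else 0

theorem adjG0_isHermitian : adjG0.IsHermitian := by
  classical
  exact g0.isHermitian_adjMatrix ℂ

theorem norm_adjG0_apply_le (v w : G0Vertex) : ‖adjG0 v w‖ ≤ 1 := by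
  rw [adjG0, SimpleGraph.adjMatrix_apply]
  split_ifs <;> simp

theorem adjG0_eq : adjG0 = hopMatrix + hopMatrixᴴ + shiftMatrix := by
  classical
  have ht : ∀ a : ZMod 8, a ≠ a + 1 ∧ a ≠ a + 1 + 1 := by decide
  ext w v
  have h12 : G0Step v w → ¬G0Step w v := fun h h' => (ht _).2 (h'.1.trans (by rw [h.1]))
  have h13 : G0Step v w → ¬G0Shift v w := fun h h' => (ht _).1 (h'.2.1.symm.trans h.1)
  have h23 : G0Step w v → ¬G0Shift v w := fun h h' => (ht _).1 (h'.2.1.trans h.1)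
  have hadj : g0.Adj w v ↔ G0Step v w ∨ G0Step w v ∨ G0Shift v w := g0.adj_comm w v
  have hhop (w v : G0Vertex) : hopMatrix w v = if G0Step v w then 1 else 0 :=
    if_congr Iff.rfl rfl rfl
  have hshift : shiftMatrix w v = if G0Shift v w then 1 else 0 := if_congr Iff.rfl rfl rfl
  simp only [adjG0, SimpleGraph.adjMatrix_apply, hadj, Matrix.add_apply, conjTranspose_apply,
    hhop, hshift]
  by_cases h1 : G0Step v w
  · simp [h1, h12 h1, h13 h1]
  · by_cases h2 : G0Step w v
    · simp [h1, h2, h23 h2]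
    · simp [h1, h2]

theorem vecMul_hopMatrix (g : G0Vertex → ℂ) (z : Fin 2) (t j : ZMod 8) :
    (g ᵥ* hopMatrix) (z, t, j) = ∑ z', g (z', t + 1, j + gateExp t z' z) := by
  simp only [vecMul, dotProduct, hopMatrix, of_apply, ite_and, mul_ite, mul_one, mul_zero,
    Fintype.sum_prod_type, Finset.sum_ite_irrel, Finset.sum_const_zero, Finset.sum_ite_eq',
    Finset.mem_univ, if_true]

theorem vecMul_shiftMatrix (g : G0Vertex → ℂ) (z : Fin 2) (t j : ZMod 8) :
    (g ᵥ* shiftMatrix) (z, t, j) = g (z, t, j + 3) + g (z, t, j + 4) + g (z, t, j + 5) := by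
  have hne : ∀ i : ZMod 8, i + 3 ≠ i + 4 ∧ i + 3 ≠ i + 5 ∧ i + 4 ≠ i + 5 := by decide
  have hsplit (i : ZMod 8) (c : ℂ) : (if i = j + 3 ∨ i = j + 4 ∨ i = j + 5 then c else 0) =
      (if i = j + 3 then c else 0) + (if i = j + 4 then c else 0) +
        if i = j + 5 then c else 0 := by
    have := hne j
    grind
  simp only [vecMul, dotProduct, shiftMatrix, of_apply, ite_and, hsplit, mul_add,
    mul_ite, mul_one, mul_zero, Fintype.sum_prod_type, Finset.sum_ite_irrel,
    Finset.sum_const_zero, Finset.sum_add_distrib, Finset.sum_ite_eq', Finset.mem_univ, if_true]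

/-- The component of momentum `k` of a state of `g₀`, indexed by the time: the Fourier transform in
the register `j`. -/
def momentumState (f : G0Vertex → ℂ) (k t : ZMod 8) (z : Fin 2) : ℂ :=
  𝓕 (fun j => f (z, t, j)) k

theorem sum_normSq_momentumState (f : G0Vertex → ℂ) (t : ZMod 8) :
    ∑ k, normSq (momentumState f k t) = 8 * ∑ z, ∑ j, ‖f (z, t, j)‖ ^ 2 := by
  simp only [normSq, momentumState]
  rw [Finset.sum_comm, Finset.mul_sum]
  exact Finset.sum_congr rfl fun z _ => normSq_dft fun j => f (z, t, j)

theorem dotProduct_hopMatrix_mulVec (f : G0Vertex → ℂ) :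
    8 * (star f ⬝ᵥ hopMatrix *ᵥ f) =
      ∑ k, ∑ t, star (momentumState f k (t + 1)) ⬝ᵥ hop k t *ᵥ momentumState f k t := by
  have hcorr (t : ZMod 8) (z z' : Fin 2) :
      8 * ∑ j, star (f (z', t + 1, j + gateExp t z' z)) * f (z, t, j) =
        ∑ k, hop k t z' z * (star (momentumState f k (t + 1) z') * momentumState f k t z) :=
    (sum_stdAddChar_mul_star_dft_mul_dft (fun j => f (z', t + 1, j)) (fun j => f (z, t, j)) _).symm
  calc 8 * (star f ⬝ᵥ hopMatrix *ᵥ f)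
      = ∑ t, ∑ z, ∑ z', 8 * ∑ j, star (f (z', t + 1, j + gateExp t z' z)) * f (z, t, j) := by
        rw [dotProduct_mulVec]
        simp only [dotProduct, Fintype.sum_prod_type, vecMul_hopMatrix, Pi.star_apply,
          Finset.sum_mul, Finset.mul_sum]
        rw [Finset.sum_comm]
        exact Finset.sum_congr rfl fun t _ => Finset.sum_congr rfl fun z _ => Finset.sum_comm
    _ = ∑ t, ∑ z, ∑ z', ∑ k,
          hop k t z' z * (star (momentumState f k (t + 1) z') * momentumState f k t z) := by
        simp only [hcorr]
    _ = ∑ k, ∑ t, star (momentumState f k (t + 1)) ⬝ᵥ hop k t *ᵥ momentumState f k t := by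
        simp only [dotProduct, mulVec, Finset.mul_sum, Pi.star_apply, mul_left_comm (star _)]
        symm
        rw [Finset.sum_comm]
        refine Finset.sum_congr rfl fun t _ => ?_
        rw [Finset.sum_comm]
        exact (Finset.sum_congr rfl fun z' _ => Finset.sum_comm).trans Finset.sum_comm

theorem dotProduct_shiftMatrix_mulVec (f : G0Vertex → ℂ) :
    8 * (star f ⬝ᵥ shiftMatrix *ᵥ f) =
      ∑ k, (stdAddChar (-(3 * k)) + stdAddChar (-(4 * k)) + stdAddChar (-(5 * k))) *
        ((∑ t, normSq (momentumState f k t) : ℝ) : ℂ) := by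
  have hcorr (t : ZMod 8) (z : Fin 2) (c : ZMod 8) :
      8 * ∑ j, star (f (z, t, j + c)) * f (z, t, j) =
        ∑ k, stdAddChar (-(c * k)) * (star (momentumState f k t z) * momentumState f k t z) :=
    (sum_stdAddChar_mul_star_dft_mul_dft (fun j => f (z, t, j)) (fun j => f (z, t, j)) c).symm
  have hnorm (k : ZMod 8) : ((∑ t, normSq (momentumState f k t) : ℝ) : ℂ) =
      ∑ z, ∑ t, star (momentumState f k t z) * momentumState f k t z := by
    simp only [normSq, Complex.ofReal_sum, Complex.ofReal_pow, Complex.star_def,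
      Complex.conj_mul']
    exact Finset.sum_comm
  calc 8 * (star f ⬝ᵥ shiftMatrix *ᵥ f)
      = ∑ z, ∑ t, (8 * ∑ j, star (f (z, t, j + 3)) * f (z, t, j) +
          8 * ∑ j, star (f (z, t, j + 4)) * f (z, t, j) +
          8 * ∑ j, star (f (z, t, j + 5)) * f (z, t, j)) := by
        rw [dotProduct_mulVec]
        simp only [dotProduct, Fintype.sum_prod_type, vecMul_shiftMatrix, Pi.star_apply, add_mul,
          Finset.sum_add_distrib, Finset.mul_sum, mul_add]
    _ = ∑ z, ∑ t, ∑ k, (stdAddChar (-(3 * k)) + stdAddChar (-(4 * k)) + stdAddChar (-(5 * k))) *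
          (star (momentumState f k t z) * momentumState f k t z) := by
        simp only [hcorr, add_mul, Finset.sum_add_distrib]
    _ = _ := by
        simp only [hnorm, Finset.mul_sum]
        symm
        rw [Finset.sum_comm]
        exact Finset.sum_congr rfl fun z _ => Finset.sum_comm

theorem quadForm_adjG0 (f : G0Vertex → ℂ) :
    8 * quadForm adjG0 f = ∑ k, (hopEnergy k (momentumState f k) +
      shiftEnergy k * ∑ t, normSq (momentumState f k t)) := by
  have hconj : star f ⬝ᵥ hopMatrixᴴ *ᵥ f = star (star f ⬝ᵥ hopMatrix *ᵥ f) := by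
    rw [← star_dotProduct_star, star_mulVec, star_star, ← dotProduct_mulVec]
  have hhop := congrArg Complex.re (dotProduct_hopMatrix_mulVec f)
  have hshift := congrArg Complex.re (dotProduct_shiftMatrix_mulVec f)
  rw [show (8 : ℂ) = ((8 : ℝ) : ℂ) by norm_num, Complex.re_ofReal_mul,
    Complex.re_sum] at hhop hshift
  simp only [Complex.re_mul_ofReal] at hshift
  rw [adjG0_eq, quadForm_add, quadForm_add, quadForm, quadForm, quadForm, hconj, Complex.star_def,
    Complex.conj_re, Finset.sum_add_distrib]
  simp only [hopEnergy, shiftEnergy, ← Finset.mul_sum]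
  linarith

theorem quadForm_adjG0_add_ge (f : G0Vertex → ℂ) (t₀ : ZMod 8) :
    (e1 + 1 / 128) * normSq f ≤ quadForm adjG0 f + 2 * ∑ z, ∑ j, ‖f (z, t₀, j)‖ ^ 2 := by
  have hsum := Finset.sum_le_sum fun k (_ : k ∈ Finset.univ) =>
    mul_sum_normSq_le_hopEnergy_add k (momentumState f k) t₀
  have hnorm : normSq f = ∑ t, ∑ z, ∑ j, ‖f (z, t, j)‖ ^ 2 := by
    simp only [normSq, Fintype.sum_prod_type]
    exact Finset.sum_comm
  rw [Finset.sum_add_distrib, ← quadForm_adjG0, ← Finset.mul_sum, ← Finset.mul_sum,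
    sum_normSq_momentumState, Finset.sum_comm] at hsum
  simp only [sum_normSq_momentumState] at hsum
  rw [← Finset.mul_sum, ← hnorm] at hsum
  linarith

end AdjG0

/-! ### Gate graphs -/

theorem le_of_mem_eigenvalues_of_sum_norm_le {ι : Type*} [Fintype ι] {M : Matrix ι ι ℂ} {K x : ℝ}
    (hM : ∀ i, ∑ j, ‖M i j‖ ≤ K) (hx : x ∈ eigenvalues M) : x ≤ K := by
  classical
  obtain ⟨v, -, hv0, hv⟩ := hx
  have hev : Module.End.HasEigenvalue (Matrix.toLin' M) (x : ℂ) :=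
    Module.End.hasEigenvalue_of_hasEigenvector (Module.End.hasEigenvector_iff.mpr
      ⟨Module.End.mem_eigenspace_iff.mpr (by rw [toLin'_apply, hv]), hv0⟩)
  obtain ⟨i, hi⟩ := eigenvalue_mem_ball hev
  rw [mem_closedBall_iff_norm] at hi
  calc x ≤ ‖(x : ℂ)‖ := by rw [Complex.norm_real]; exact le_abs_self x
    _ ≤ ‖M i i‖ + ‖(x : ℂ) - M i i‖ := norm_le_norm_add_norm_sub' _ _
    _ ≤ ‖M i i‖ + ∑ j ∈ Finset.univ.erase i, ‖M i j‖ := by gcongr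
    _ = ∑ j, ‖M i j‖ := Finset.add_sum_erase _ (fun j => ‖M i j‖) (Finset.mem_univ i)
    _ ≤ K := hM i

theorem sum_norm_one_kronecker_apply {κ ι : Type*} [Fintype κ] [DecidableEq κ] [Fintype ι]
    (M : Matrix ι ι ℂ) (v : κ × ι) :
    ∑ w, ‖((1 : Matrix κ κ ℂ) ⊗ₖ M) v w‖ = ∑ u, ‖M v.2 u‖ := by
  simp [Fintype.sum_prod_type, kroneckerMap_apply, Matrix.one_apply, apply_ite]

theorem quadForm_one_kronecker {κ ι : Type*} [Fintype κ] [DecidableEq κ] [Fintype ι]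
    (M : Matrix ι ι ℂ) (v : κ × ι → ℂ) :
    quadForm ((1 : Matrix κ κ ℂ) ⊗ₖ M) v = ∑ q, quadForm M fun u => v (q, u) := by
  simp [quadForm, dotProduct, mulVec, Fintype.sum_prod_type, kroneckerMap_apply, Matrix.one_apply]

theorem exists_notMem_times (l : UnitaryLabel) : ∃ t, t ∉ l.times := by
  cases l
  · exact ⟨2, by simp only [UnitaryLabel.times, Set.mem_insert_iff, Set.mem_singleton_iff]; decide⟩
  · exact ⟨4, by simp only [UnitaryLabel.times, Set.mem_insert_iff, Set.mem_singleton_iff]; decide⟩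
  · exact ⟨2, by simp only [UnitaryLabel.times, Set.mem_insert_iff, Set.mem_singleton_iff]; decide⟩

namespace GateDiagram

variable {R : ℕ} (D : GateDiagram R)

theorem posSemidef_hS : D.hS.PosSemidef := by
  classical
  refine .diagonal fun v => ?_
  simp only [Pi.zero_apply]
  split_ifs <;> simp

theorem posSemidef_projNoLoop : D.projNoLoop.PosSemidef := by
  classical
  refine .diagonal fun v => ?_
  simp only [Pi.zero_apply]
  split_ifs <;> simp

theorem posSemidef_hE : D.hE.PosSemidef := by
  classical
  refine posSemidef_sum _ fun e _ => ?_
  let χ : Node R → ℂ := fun n => if n ∈ e then 1 else 0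
  have h := ((posSemidef_vecMulVec_self_star χ).kronecker
    (.one : (1 : Matrix (ZMod 8) (ZMod 8) ℂ).PosSemidef)).submatrix
      fun v : Vertex R => (v.node, v.2.2.2)
  refine (congrArg PosSemidef ?_).mpr h
  ext v w
  by_cases hv : v.node ∈ e <;> by_cases hw : w.node ∈ e <;>
    simp [χ, vecMulVec_apply, Matrix.one_apply, hv, hw]

theorem isHermitian_adj : D.adj.IsHermitian := by
  refine (IsHermitian.add ?_ D.posSemidef_hS.isHermitian).add D.posSemidef_hE.isHermitian
  rw [IsHermitian, conjTranspose_kronecker, adjG0_isHermitian.eq, conjTranspose_one]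

theorem sum_norm_hE_apply_le (v : Vertex R) : ∑ w, ‖D.hE v w‖ ≤ 2 := by
  classical
  by_cases hv : ∃ e ∈ D.edges, Vertex.node v ∈ e
  · obtain ⟨e, he, hve⟩ := hv
    have hentry (w : Vertex R) :
        ‖D.hE v w‖ = if Vertex.node w ∈ e ∧ v.2.2.2 = w.2.2.2 then 1 else 0 := by
      rw [hE, Matrix.sum_apply, Finset.sum_eq_single e]
      · simp [hve, apply_ite]
      · exact fun e' he' hne => if_neg fun h => hne (D.edge_unique e' he' e he _ h.1 hve)
      · exact fun h => (h he).elim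
    simp only [hentry, Finset.sum_boole]
    have hcard : ({w | Vertex.node w ∈ e ∧ v.2.2.2 = w.2.2.2} : Finset (Vertex R)).card ≤
        e.toFinset.card := by
      refine Finset.card_le_card_of_injOn Vertex.node (fun w hw => by simp_all) ?_
      intro w hw w' hw' h
      simp only [Finset.coe_filter, Finset.mem_univ, true_and, Set.mem_ofPred_eq] at hw hw'
      simp only [Vertex.node, Prod.mk.injEq] at h
      exact Prod.ext h.1 (Prod.ext h.2.1 (Prod.ext h.2.2 (hw.2.symm.trans hw'.2)))
    have hcard_edge : e.toFinset.card ≤ 2 := by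
      rw [Sym2.card_toFinset]
      split_ifs <;> simp
    exact_mod_cast hcard.trans hcard_edge
  · push Not at hv
    have hentry (w : Vertex R) : D.hE v w = 0 := by
      rw [hE, Matrix.sum_apply]
      exact Finset.sum_eq_zero fun e he => if_neg fun h => hv e he h.1
    simp [hentry]

theorem sum_norm_adj_apply_le (v : Vertex R) : ∑ w, ‖D.adj v w‖ ≤ 131 := by
  have hkron : ∑ w, ‖((1 : Matrix (Fin R) (Fin R) ℂ) ⊗ₖ adjG0) v w‖ ≤ 128 := by
    rw [sum_norm_one_kronecker_apply]
    exact (Finset.sum_le_card_nsmul _ _ 1 fun u _ => norm_adjG0_apply_le v.2 u).trans_eq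
      (by simp)
  have hS_le : ∑ w, ‖D.hS v w‖ ≤ 1 := by
    rw [Finset.sum_eq_single_of_mem v (Finset.mem_univ v) fun w _ hw => by
      rw [hS, diagonal_apply_ne' _ hw, norm_zero], hS, diagonal_apply_eq]
    split_ifs <;> simp
  calc ∑ w, ‖D.adj v w‖ ≤ ∑ w, (‖((1 : Matrix (Fin R) (Fin R) ℂ) ⊗ₖ adjG0) v w‖ + ‖D.hS v w‖ +
        ‖D.hE v w‖) := Finset.sum_le_sum fun w _ => norm_add₃_le
    _ ≤ 131 := by
      rw [Finset.sum_add_distrib, Finset.sum_add_distrib]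
      linarith [D.sum_norm_hE_apply_le v]

variable {D} in
theorem mem_noLoop_of_notMem_times {q : Fin R} {t : ZMod 8} (ht : t ∉ (D.label q).times)
    (z : Fin 2) (j : ZMod 8) : ((q, z, t, j) : Vertex R) ∈ D.noLoop :=
  ⟨fun h => ht (D.loops_appear _ h), fun _ h => ht (D.edges_appear _ h _ (Sym2.mem_mk_left _ _))⟩

theorem sum_norm_sq_le_quadForm_projNoLoop {t : Fin R → ZMod 8}
    (ht : ∀ q, t q ∉ (D.label q).times) (v : Vertex R → ℂ) :
    ∑ q, ∑ z, ∑ j, ‖v (q, z, t q, j)‖ ^ 2 ≤ quadForm D.projNoLoop v := by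
  classical
  have hproj : D.projNoLoop = diagonal fun v => ((if v ∈ D.noLoop then 1 else 0 : ℝ) : ℂ) := by
    simp only [projNoLoop, apply_ite Complex.ofReal, Complex.ofReal_one, Complex.ofReal_zero]
  have hnonneg (w : Vertex R) : 0 ≤ (if w ∈ D.noLoop then 1 else 0) * ‖v w‖ ^ 2 := by positivity
  rw [hproj, quadForm_diagonal]
  simp only [Fintype.sum_prod_type]
  refine Finset.sum_le_sum fun q _ => Finset.sum_le_sum fun z _ => le_trans ?_
    (Finset.single_le_sum (f := fun s => ∑ j, (if ((q, z, s, j) : Vertex R) ∈ D.noLoop then 1 else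
      0) * ‖v (q, z, s, j)‖ ^ 2)
      (fun s _ => Finset.sum_nonneg fun j _ => hnonneg _) (Finset.mem_univ (t q)))
  simp only [if_pos (mem_noLoop_of_notMem_times (ht q) z _), one_mul, le_refl]

theorem quadForm_adj_add_projNoLoop_ge (v : Vertex R → ℂ) :
    (e1 + 1 / 128) * normSq v ≤ quadForm (D.adj + (2 : ℂ) • D.projNoLoop) v := by
  choose t ht using fun q => exists_notMem_times (D.label q)
  have hg0 := Finset.sum_le_sum fun q (_ : q ∈ Finset.univ) =>
    quadForm_adjG0_add_ge (fun u => v (q, u)) (t q)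
  have hnorm : normSq v = ∑ q, normSq fun u => v (q, u) := Fintype.sum_prod_type _
  rw [Finset.sum_add_distrib, ← Finset.mul_sum, ← Finset.mul_sum, ← hnorm,
    ← quadForm_one_kronecker] at hg0
  rw [show (2 : ℂ) = ((2 : ℝ) : ℂ) by norm_num, quadForm_add, quadForm_smul, adj, quadForm_add,
    quadForm_add]
  linarith [quadForm_nonneg D.posSemidef_hS v, quadForm_nonneg D.posSemidef_hE v,
    D.sum_norm_sq_le_quadForm_projNoLoop ht v]

variable {D}

theorem groundEnergy_adjSL_le (hR : 0 < R) (D : GateDiagram R) (N : ℕ) :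
    groundEnergy N D.adjSL ≤ groundEnergy N D.adj :=
  have : NeZero R := ⟨hR.ne'⟩
  groundEnergy_doubling_le D.isHermitian_adj D.posSemidef_projNoLoop N

theorem IsE1GateGraph.pos (hD : D.IsE1GateGraph) : 0 < R := by
  obtain ⟨⟨v, -, hv, -⟩, -⟩ := hD
  obtain ⟨w, -⟩ := Function.ne_iff.mp hv
  exact w.1.pos

theorem IsE1GateGraph.minEigenvalue_adj (hD : D.IsE1GateGraph) : minEigenvalue D.adj = e1 :=
  hD.csInf_eq

theorem IsE1GateGraph.groundEnergy_adj_nonneg (hD : D.IsE1GateGraph) (N : ℕ) :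
    0 ≤ groundEnergy N D.adj :=
  have : NeZero R := ⟨hD.pos.ne'⟩
  groundEnergy_nonneg D.isHermitian_adj N

theorem IsE1GateGraph.posSemidef_adj_sub (hD : D.IsE1GateGraph) :
    (D.adj - (e1 : ℂ) • 1).PosSemidef := by
  rw [← hD.minEigenvalue_adj]
  exact posSemidef_sub_minEigenvalue D.isHermitian_adj

theorem IsE1GateGraph.gap_adj_sub_le (hD : D.IsE1GateGraph) :
    gap (D.adj - (e1 : ℂ) • 1) ≤ 140 := by
  rcases Set.eq_empty_or_nonempty {x | x ∈ eigenvalues (D.adj - (e1 : ℂ) • 1) ∧ x ≠ 0}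
    with hempty | ⟨x, hx, hx0⟩
  · rw [gap, hempty, Real.sInf_empty]
    norm_num
  · have hle := le_of_mem_eigenvalues_of_sum_norm_le D.sum_norm_adj_apply_le
      (mem_eigenvalues_sub_smul_one.mp hx)
    have hsqrt : √2 ≤ 2 := Real.sqrt_le_iff.mpr (by norm_num)
    have hgap := gap_le hD.posSemidef_adj_sub hx hx0
    rw [e1] at hle hgap ⊢
    linarith

theorem IsE1GateGraph.gap_div_mul_groundEnergy_adj_le (hD : D.IsE1GateGraph) (N : ℕ) :
    gap (D.adj - (e1 : ℂ) • 1) / (179200 * N ^ 2) * groundEnergy N D.adj ≤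
      groundEnergy N D.adjSL := by
  have : NeZero R := ⟨hD.pos.ne'⟩
  have hcoercive (s : Vertex R → ℂ) : 1 / 128 * normSq s ≤
      quadForm (D.adj - (minEigenvalue D.adj : ℂ) • 1 + (2 : ℂ) • D.projNoLoop) s := by
    rw [hD.minEigenvalue_adj, sub_add_eq_add_sub, quadForm_sub_smul_one]
    linarith [D.quadForm_adj_add_projNoLoop_ge s]
  have hmin : min (gap (D.adj - (minEigenvalue D.adj : ℂ) • 1)) (1 / 128) *
      groundEnergy N D.adj ≤ 10 * N ^ 2 * groundEnergy N D.adjSL :=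
    min_gap_mul_groundEnergy_le D.isHermitian_adj D.posSemidef_projNoLoop
      (by norm_num) (by norm_num) hcoercive N
  rw [hD.minEigenvalue_adj] at hmin
  set γ := gap (D.adj - (e1 : ℂ) • 1)
  have hγ : γ / 17920 ≤ min γ (1 / 128) :=
    le_min (by linarith [gap_nonneg hD.posSemidef_adj_sub]) (by linarith [hD.gap_adj_sub_le])
  have hle := (mul_le_mul_of_nonneg_right hγ (hD.groundEnergy_adj_nonneg N)).trans hmin
  have hSL : 0 ≤ groundEnergy N D.adjSL := groundEnergy_nonneg
    (isHermitian_doubling D.isHermitian_adj D.posSemidef_projNoLoop.isHermitian) N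
  rw [div_mul_eq_mul_div]
  exact div_le_of_le_mul₀ (by positivity) hSL (by linarith)

end GateDiagram

end BoseHubbard

end

theorem mainTheorem4_general :
    (∀ (R : ℕ), 0 < R → ∀ (D : BoseHubbard.GateDiagram R) (N : ℕ),
      BoseHubbard.groundEnergy N D.adjSL ≤ BoseHubbard.groundEnergy N D.adj) ∧
    ∃ C₁ : ℝ, 0 < C₁ ∧
      ∀ (R : ℕ) (D : BoseHubbard.GateDiagram R), D.IsE1GateGraph → ∀ (N : ℕ) (C₀ b : ℝ),
        BoseHubbard.gap (D.adj - (BoseHubbard.e1 : ℂ) • 1) ≥ C₀ / (R : ℝ) ^ 3 →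
        BoseHubbard.groundEnergy N D.adj ≥ b → b > 0 →
          BoseHubbard.groundEnergy N D.adjSL ≥ C₀ * C₁ / ((R : ℝ) ^ 3 * (N : ℝ) ^ 2) * b := by
  refine ⟨fun R hR D N => BoseHubbard.GateDiagram.groundEnergy_adjSL_le hR D N, 1 / 179200,
    by norm_num, fun R D hD N C₀ b hγ hE hb => ?_⟩
  have hγ0 := BoseHubbard.gap_nonneg hD.posSemidef_adj_sub
  calc C₀ * (1 / 179200) / ((R : ℝ) ^ 3 * (N : ℝ) ^ 2) * b
      = C₀ / (R : ℝ) ^ 3 / (179200 * (N : ℝ) ^ 2) * b := by ring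
    _ ≤ BoseHubbard.gap (D.adj - (BoseHubbard.e1 : ℂ) • 1) / (179200 * (N : ℝ) ^ 2) *
        BoseHubbard.groundEnergy N D.adj := by gcongr
    _ ≤ BoseHubbard.groundEnergy N D.adjSL := hD.gap_div_mul_groundEnergy_adj_le N

theorem mainTheorem4 :
    (∀ (R : ℕ) (D : BoseHubbard.GateDiagram R), D.IsE1GateGraph → ∀ (N : ℕ) (a : ℝ),
      BoseHubbard.groundEnergy N D.adj ≤ a →
        BoseHubbard.groundEnergy N D.adjSL ≤ 3 / 2 * a) ∧
    ∃ C₁ : ℝ, 0 < C₁ ∧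
      ∀ (R : ℕ) (D : BoseHubbard.GateDiagram R), D.IsE1GateGraph → ∀ (N : ℕ) (C₀ b : ℝ),
        BoseHubbard.gap (D.adj - (BoseHubbard.e1 : ℂ) • 1) ≥ C₀ / (R : ℝ) ^ 3 →
        BoseHubbard.groundEnergy N D.adj ≥ b → b > 0 →
          BoseHubbard.groundEnergy N D.adjSL ≥ C₀ * C₁ / ((R : ℝ) ^ 3 * (N : ℝ) ^ 2) * b := by
  refine ⟨fun R D hD N a ha => ?_, mainTheorem4_general.2⟩
  linarith [mainTheorem4_general.1 R hD.pos D N, hD.groundEnergy_adj_nonneg N]
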